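/- Let $M$ be a (connected) Riemann surface that is not homeomorphic to $S^2$, and let $f: M \to \mathbb{CP}^2$ be a (conformal) minimal Lagrangian immersion into the complex projective plane with the Fubini--Study metric of constant holomorphic sectional curvature $4$. Let $\pi_H : S^5 \to \mathbb{CP}^2$ be the Hopf fibration, $S^5 \subset \mathbb{C}^3$. A horizontal lift of a map $h: N \to \mathbb{CP}^2$ is a smooth map $\mathfrak h : N \to S^5$ with $\pi_H \circ \mathfrak h = h$ and $d\mathfrak h \cdot \overline{\mathfrak h} = 0$. If $h$ is conformal with induced metric $2e^u\,dz\,d\bar z$, the coordinate frame of $\mathfrak h$ is $\mathcal F(\mathfrak h) = (e^{-u/2}\mathfrak h_z,\ e^{-u/2}\mathfrak h_{\bar z},\ \mathfrak h)$; its determinant does not depend on the holomorphic coordinate $z$. Let $\mathbb A_3 \subset S^1$ be the group of cubic roots of unity. (1) Let $\pi: \mathbb D \to M$ be the universal covering (a holomorphic covering by a simply connected Riemann surface), on which $\pi_1(M)$ acts by deck transformations, and let $\tilde f = f\circ \pi$. Then $\tilde f$ has a horizontal lift $\tilde{\mathfrak f}: \mathbb D \to S^5$ with $\det \mathcal F(\tilde{\mathfrak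 f}) = 1$. For every such lift there is a homomorphism $c: \pi_1(M) \to S^1$ with $\tilde{\mathfrak f}(\gamma . z) = c(\gamma)\, \tilde{\mathfrak f}(z)$ for all $\gamma \in \pi_1(M)$, $z \in \mathbb D$; it satisfies $c(\gamma)^3 = 1$ for all $\gamma$, and its image is $\{1\}$ or $\mathbb A_3$. Put $\Gamma = \ker c$ and $\hat M = \Gamma \backslash \mathbb D$, and let $\hat\pi : \mathbb D \to \hat M$ and $\tau: \hat M \to M$ be the natural maps, so that $\pi = \tau\circ\hat\pi$. Then $\hat M$ carries the structure of a Riemann surface for which $\hat\pi$ and $\tau$ are holomorphic coverings; the deck group of $\hat\pi$ is $\Gamma$; $\hat f = f \circ \tau$ is a minimal Lagrangian immersion; and there is a global horizontal lift $\hat{\mathfrak f} : \hat M \to S^5$ of $\hat f$ with $\hat{\mathfrak f} \circ \hat \pi = \tilde{\mathfrak f}$. Moreover, either $c$ is trivial, $\tau$ is bijective, and $f$ itself has a global horizontal lift $\mathfrak f : M \to S^5$ with $\mathfrak f \circ \pi = \tilde{\mathfrak f}$; or the image of $c$ is $\mathbb A_3$, $\tau$ is a threefold covering, $f$ has no global horizontal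 lift, and $\pi_1(M)/\Gamma \cong \mathbb A_3$. (2) Consequently, either $f$ has a global horizontal lift $\mathfrak f: M \to S^5$, or $f$ has no such lift but there are a Riemann surface $\hat M$ and a holomorphic threefold covering $\tau: \hat M \to M$ such that $f \circ \tau$ is a minimal Lagrangian immersion which has a global horizontal lift, $\tau_*\pi_1(\hat M)$ is normal in $\pi_1(M)$, and $\pi_1(M)/\tau_*\pi_1(\hat M) \cong \mathbb A_3 \cong \mathbb Z/3$. -/

import Mathlib

open Set Function Manifold ContDiff

noncomputable section

namespace MinLag

/-! ### Riemann surfaces, coverings, deck transformations -/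

/-- A Riemann surface: a connected Hausdorff space with a holomorphic atlas of complex dimension
one. -/
structure IsRiemannSurface (M : Type*) [TopologicalSpace M] [ChartedSpace ℂ M] : Prop where
  t2 : T2Space M
  connected : ConnectedSpace M
  holomorphic : IsManifold 𝓘(ℂ) ω M

/-- A holomorphic covering map. -/
structure IsHolomorphicCovering {N M : Type*} [TopologicalSpace N] [ChartedSpace ℂ N]
    [TopologicalSpace M] [ChartedSpace ℂ M] (p : N → M) : Prop where
  covering : IsCoveringMap p
  holomorphic : MDifferentiable 𝓘(ℂ) 𝓘(ℂ) p

/-- The group of deck transformations of `p : D → M`. When `p` is the universal covering this is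
the fundamental group of `M` acting on `D`. -/
def deckGroup {D M : Type*} [TopologicalSpace D] (p : D → M) : Subgroup (D ≃ₜ D) where
  carrier := {γ | ∀ x, p (γ x) = p x}
  mul_mem' := by
    intro a b ha hb x
    rw [Homeomorph.mul_apply, ha, hb]
  one_mem' := fun _ => rfl
  inv_mem' := by
    intro a ha x
    have h := ha (a.symm x)
    rw [Homeomorph.apply_symm_apply] at h
    exact h.symm

instance deckAction {D M : Type*} [TopologicalSpace D] (p : D → M) :
    MulAction (deckGroup p) D where
  smul γ x := γ.1 x
  one_smul _ := rfl
  mul_smul _ _ _ := rfl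

/-- The quotient of `D` by the kernel of a character `c` of the deck group. -/
abbrev HatM {D M : Type*} [TopologicalSpace D] {p : D → M} (c : deckGroup p →* Circle) : Type _ :=
  Quotient (MulAction.orbitRel c.ker D)

/-- The projection `D → ker c \ D`. -/
def toHatM {D M : Type*} [TopologicalSpace D] {p : D → M} (c : deckGroup p →* Circle) :
    D → HatM c :=
  Quotient.mk (MulAction.orbitRel c.ker D)

/-- The map `ker c \ D → M` induced by `p : D → M`. -/
def fromHatM {D M : Type*} [TopologicalSpace D] {p : D → M} (c : deckGroup p →* Circle) :
    HatM c → M :=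
  Quotient.lift p (by
    rintro a b ⟨γ, rfl⟩
    exact γ.1.2 b)

/-- The group of cubic roots of unity in the circle. -/
def cubeRoots : Subgroup Circle := (powMonoidHom 3 : Circle →* Circle).ker

/-! ### The complex projective plane and the Hopf fibration -/

/-- `ℂ³` with its Hermitian inner product; `inner ℂ W Z = ∑ conj (W k) * Z k`. -/
abbrev C3 : Type := EuclideanSpace ℂ (Fin 3)

/-- The unit sphere of `ℂ³`. -/
abbrev S5 : Type := Metric.sphere (0 : C3) 1

/-- The complex projective plane. -/
abbrev CP2 : Type := Projectivization ℂ C3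

/-- The Hopf fibration. -/
def hopf (v : S5) : CP2 :=
  Projectivization.mk ℂ (v : C3) (by
    intro h
    have h1 : ‖(v : C3)‖ = 1 := mem_sphere_zero_iff_norm.mp v.2
    rw [h, norm_zero] at h1
    exact zero_ne_one h1)

/-! ### Local geometry of a map into the projective plane, through a lift to the sphere

In this part `G` is a map to the unit sphere of `ℂ³`, defined near the point `z` of the coordinate
plane `ℂ = ℝ²`, and `[G]` is the induced map to the projective plane. The projective plane carries
the Fubini-Study metric of constant holomorphic sectional curvature `4`, which is the metric that
makes the Hopf fibration a Riemannian submersion: tangent vectors of the projective plane are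
represented by their horizontal lifts at `G z`, i.e. by vectors of `ℂ³` that are Hermitian
orthogonal to `G z`; the metric is the real part of the Hermitian product of horizontal lifts, and
the Kähler form is (up to sign) its imaginary part. -/

/-- The real partial derivative of `G` in the direction `v`. -/
def pd (G : ℂ → C3) (z v : ℂ) : C3 := fderiv ℝ G z v

/-- The horizontal part at `p` of a vector `w`. -/
def hor (p w : C3) : C3 := w - inner ℂ p w • p

/-- The horizontal lift at `G z` of the vector `d[G]_z (v)`. -/
def hd (G : ℂ → C3) (z v : ℂ) : C3 := hor (G z) (pd G z v)

/-- The metric induced by the Fubini-Study metric through `[G]`. -/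
def indMetric (G : ℂ → C3) (z v w : ℂ) : ℝ := (inner ℂ (hd G z v) (hd G z w)).re

/-- The pull back of the Kähler form through `[G]`. -/
def indKahler (G : ℂ → C3) (z v w : ℂ) : ℝ := (inner ℂ (hd G z v) (hd G z w)).im

/-- The horizontal lift at `G z` of the covariant derivative, for the Levi-Civita connection of
the Fubini-Study metric, of the vector field `ζ ↦ d[G]_ζ (w)` along `[G]` in the direction `v`.

The Levi-Civita connection of the base of a Riemannian submersion is the horizontal part of the
one of the total space, applied to horizontal lifts. The second term takes account of the vertical
component of `dG (v)`: if `G` is replaced by `g • G` with `g` of modulus one, the horizontal lift is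
multiplied by `g` as well, and for a `g` that makes `d(g • G)_z (v)` horizontal the second term
disappears. -/
def covDeriv (G : ℂ → C3) (z v w : ℂ) : C3 :=
  hor (G z) (fderiv ℝ (fun ζ => hd G ζ w) z v - inner ℂ (G z) (pd G z v) • hd G z w)

/-- The trace of the second covariant derivative of `[G]` with respect to the induced metric,
multiplied by the determinant of the induced metric in the frame `1, I` of `ℂ = ℝ²`. Its
normal part is the trace of the second fundamental form times that determinant. -/
def traceHess (G : ℂ → C3) (z : ℂ) : C3 :=
  indMetric G z Complex.I Complex.I • covDeriv G z 1 1
    - indMetric G z 1 Complex.I • (covDeriv G z 1 Complex.I + covDeriv G z Complex.I 1)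
    + indMetric G z 1 1 • covDeriv G z Complex.I Complex.I

/-- `[G]` has vanishing mean curvature vector at `z`: the trace of the second fundamental form is
orthogonal to every vector `N` that is tangent to the projective plane and normal to `[G]`. -/
def MeanCurvatureZero (G : ℂ → C3) (z : ℂ) : Prop :=
  ∀ N : C3, inner ℂ (G z) N = 0 → (inner ℂ (hd G z 1) N).re = 0 →
    (inner ℂ (hd G z Complex.I) N).re = 0 → (inner ℂ (traceHess G z) N).re = 0

/-- The differential of `[G]` at `z` is injective. -/
def Immersive (G : ℂ → C3) (z : ℂ) : Prop := ∀ v : ℂ, hd G z v = 0 → v = 0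

/-- `[G]` is conformal at `z`: the induced metric is a multiple of the Euclidean metric of
`ℂ = ℝ²`. -/
def ConformalAt (G : ℂ → C3) (z : ℂ) : Prop :=
  indMetric G z 1 1 = indMetric G z Complex.I Complex.I ∧ indMetric G z 1 Complex.I = 0

/-- `[G]` is Lagrangian at `z`: the pull back of the Kähler form vanishes. -/
def LagrangianAt (G : ℂ → C3) (z : ℂ) : Prop := ∀ v w : ℂ, indKahler G z v w = 0

/-! ### Minimal Lagrangian immersions of a Riemann surface -/

section Surface

variable {M : Type*} [TopologicalSpace M] [ChartedSpace ℂ M]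

/-- The expression of a map to the sphere in the inverse of a chart. -/
def inChart (F : M → S5) (e : OpenPartialHomeomorph M ℂ) : ℂ → C3 := fun z => (F (e.symm z) : C3)

/-- On the open set `U`, the map `F` is a smooth lift of `f` to the sphere. -/
structure IsLocalLift (f : M → CP2) (U : Set M) (F : M → S5) : Prop where
  isOpen : IsOpen U
  smooth : ContMDiffOn 𝓘(ℝ, ℂ) 𝓘(ℝ, C3) ∞ (fun x => (F x : C3)) U
  lift : ∀ x ∈ U, hopf (F x) = f x

/-- A minimal Lagrangian immersion of a Riemann surface in the projective plane, the
complex structure of the surface being the one of the induced metric, i.e. the immersion being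
conformal. Smoothness of `f` is expressed through local smooth lifts, the Hopf fibration
being a surjective submersion. The conditions do not depend on the local lift and on the
holomorphic coordinate. -/
structure IsMinimalLagrangianImmersion (f : M → CP2) : Prop where
  smooth : ∀ x : M, ∃ (U : Set M) (F : M → S5), x ∈ U ∧ IsLocalLift f U F
  immersive : ∀ (U : Set M) (F : M → S5), IsLocalLift f U F → ∀ e ∈ atlas ℂ M,
    ∀ z ∈ e.target, e.symm z ∈ U → Immersive (inChart F e) z
  conformal : ∀ (U : Set M) (F : M → S5), IsLocalLift f U F → ∀ e ∈ atlas ℂ M,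
    ∀ z ∈ e.target, e.symm z ∈ U → ConformalAt (inChart F e) z
  lagrangian : ∀ (U : Set M) (F : M → S5), IsLocalLift f U F → ∀ e ∈ atlas ℂ M,
    ∀ z ∈ e.target, e.symm z ∈ U → LagrangianAt (inChart F e) z
  minimal : ∀ (U : Set M) (F : M → S5), IsLocalLift f U F → ∀ e ∈ atlas ℂ M,
    ∀ z ∈ e.target, e.symm z ∈ U → MeanCurvatureZero (inChart F e) z

/-- A global horizontal (Legendrian) lift of `f` to the sphere. -/
structure IsHorizontalLift (f : M → CP2) (F : M → S5) : Prop where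
  smooth : ContMDiff 𝓘(ℝ, ℂ) 𝓘(ℝ, C3) ∞ (fun x => (F x : C3))
  lift : ∀ x, hopf (F x) = f x
  horizontal : ∀ e ∈ atlas ℂ M, ∀ z ∈ e.target, ∀ v : ℂ,
    inner ℂ (inChart F e z) (pd (inChart F e) z v) = 0

end Surface

/-! ### The coordinate frame -/

/-- The Wirtinger derivative with respect to `z`. -/
def dz (G : ℂ → C3) (z : ℂ) : C3 := (1 / 2 : ℂ) • (pd G z 1 - Complex.I • pd G z Complex.I)

/-- The Wirtinger derivative with respect to the conjugate of `z`. -/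
def dzbar (G : ℂ → C3) (z : ℂ) : C3 := (1 / 2 : ℂ) • (pd G z 1 + Complex.I • pd G z Complex.I)

/-- The function `u` for which the induced metric of the conformal map `[G]` is `2 eᵘ dz dz̄`. -/
def confExp (G : ℂ → C3) (z : ℂ) : ℝ := Real.log (indMetric G z 1 1 / 2)

/-- The coordinate frame, with columns `e^(-u/2) G_z`, `e^(-u/2) G_z̄` and `G`. -/
def coordFrame (G : ℂ → C3) (z : ℂ) : Matrix (Fin 3) (Fin 3) ℂ :=
  Matrix.of fun i j =>
    ![((Real.exp (-(confExp G z) / 2) : ℝ) : ℂ) * dz G z i,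
      ((Real.exp (-(confExp G z) / 2) : ℝ) : ℂ) * dzbar G z i,
      G z i] j

/-- A horizontal lift of `f` whose coordinate frame has determinant one, in the holomorphic
coordinates of the surface (the determinant does not depend on the coordinate). -/
structure IsNormalizedHorizontalLift {M : Type*} [TopologicalSpace M] [ChartedSpace ℂ M]
    (f : M → CP2) (F : M → S5) : Prop where
  isHorizontalLift : IsHorizontalLift f F
  det_eq_one : ∀ e ∈ atlas ℂ M, ∀ z ∈ e.target, (coordFrame (inChart F e) z).det = 1

end MinLag

end

open MinLag

universe u v

namespace MinLag

open Topology ComplexConjugate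

noncomputable section

/-! ### Determinants of triples of vectors -/

/-! Let `G` be a local lift of `f` to the sphere. Conformality and the Lagrangian condition make the
horizontal derivatives `hd G z 1`, `hd G z I` Hermitian orthogonal and of equal length, and both are
orthogonal to `G z`; hence the frame determinant has modulus one. Its logarithmic derivative is `3
⟨G, dG⟩` (`fderiv_frameDet`): one summand comes from differentiating the column `G`, two from the
trace of the connection form. For a Lagrangian immersion the horizontal part of that trace is the
mean curvature form, which vanishes by minimality. So a lift is horizontal exactly when its frame
determinant is locally constant.

A gauge `k` of modulus one multiplies the determinant by `k ^ 3` (`frameDet_smul`). Hence a local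
lift can be normalized to determinant one by a smooth local cube root, and the result is unique up
to cubic roots of unity. The values of normalized local lifts therefore form a subspace `LiftSpace
f` of `M × S5` that is a regular covering of `M` with group `cubeRoots`
(`isQuotientCoveringMap_liftProj`). Normalized horizontal lifts along a holomorphic local
homeomorphism `q` are the same thing as continuous lifts of `q` to this covering
(`isNormalizedHorizontalLift_of_mem`, `IsNormalizedHorizontalLift.mem_liftSet`).

The rest is covering theory. On a simply connected `D` a lift exists, and the multiplier `c` is its
monodromy, with values in a group of prime order. The map `Ψ` given by the pair of `fromHatM c` and
the descended lift embeds `HatM c` in `LiftSpace f`. Either `c` is trivial and `fromHatM c` is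
bijective, or `Ψ` is a homeomorphism onto the threefold covering. For the second statement, without
a universal covering, either a path component of `LiftSpace f` is the graph of a global lift, or
`LiftSpace f` is path connected and is itself the required covering. -/

/-- The determinant of three vectors of `ℂ³`. -/
def det3 (a b c : C3) : ℂ := Matrix.det !![a 0, b 0, c 0; a 1, b 1, c 1; a 2, b 2, c 2]

lemma det3_eq (a b c : C3) : det3 a b c = a 0 * b 1 * c 2 - a 0 * c 1 * b 2 - b 0 * a 1 * c 2
    + b 0 * c 1 * a 2 + c 0 * a 1 * b 2 - c 0 * b 1 * a 2 := by
  simp [det3, Matrix.det_fin_three]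

lemma inner_C3 (a b : C3) :
    inner ℂ a b = conj (a 0) * b 0 + conj (a 1) * b 1 + conj (a 2) * b 2 := by
  simp [PiLp.inner_apply, Fin.sum_univ_three, mul_comm]

/-- This is `det (A* B) = conj (det A) * det B`. It allows determinants to be evaluated from inner
products alone. -/
lemma conj_det3_mul_det3 (a b c x y z : C3) : conj (det3 a b c) * det3 x y z =
    Matrix.det !![inner ℂ a x, inner ℂ a y, inner ℂ a z; inner ℂ b x, inner ℂ b y, inner ℂ b z;
      inner ℂ c x, inner ℂ c y, inner ℂ c z] := by
  simp only [det3_eq, inner_C3, Matrix.det_fin_three, Matrix.of_apply, Matrix.cons_val',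
    Matrix.cons_val_zero, Matrix.cons_val_one, Matrix.cons_val, map_add, map_sub, map_mul]
  ring

lemma hasDerivAt_det3 {a b c : ℝ → C3} {a' b' c' : C3} {t : ℝ} (ha : HasDerivAt a a' t)
    (hb : HasDerivAt b b' t) (hc : HasDerivAt c c' t) :
    HasDerivAt (fun s => det3 (a s) (b s) (c s))
      (det3 a' (b t) (c t) + det3 (a t) b' (c t) + det3 (a t) (b t) c') t := by
  have h (u : ℝ → C3) (u' : C3) (hu : HasDerivAt u u' t) (i : Fin 3) :
      HasDerivAt (fun s => u s i) (u' i) t :=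
    ((EuclideanSpace.proj i : C3 →L[ℂ] ℂ).restrictScalars ℝ).hasFDerivAt.comp_hasDerivAt t hu
  have A := h a a' ha
  have B := h b b' hb
  have C := h c c' hc
  simp only [det3_eq]
  refine HasDerivAt.congr_deriv ((((((((A 0).mul (B 1)).mul (C 2)).sub
    (((A 0).mul (C 1)).mul (B 2))).sub
    (((B 0).mul (A 1)).mul (C 2))).add (((B 0).mul (C 1)).mul (A 2))).add
    (((C 0).mul (A 1)).mul (B 2))).sub (((C 0).mul (B 1)).mul (A 2))) ?_
  simp only [Pi.mul_apply]
  ring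

lemma contDiffAt_det3 {a b c : ℂ → C3} {z : ℂ} (ha : ContDiffAt ℝ ∞ a z)
    (hb : ContDiffAt ℝ ∞ b z) (hc : ContDiffAt ℝ ∞ c z) :
    ContDiffAt ℝ ∞ (fun s => det3 (a s) (b s) (c s)) z := by
  have h (u : ℂ → C3) (hu : ContDiffAt ℝ ∞ u z) (i : Fin 3) : ContDiffAt ℝ ∞ (fun s => u s i) z :=
    ((EuclideanSpace.proj i : C3 →L[ℂ] ℂ).restrictScalars ℝ).contDiff.contDiffAt.comp z hu
  have A := h a ha
  have B := h b hb
  have C := h c hc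
  simp only [det3_eq]
  exact ((((((((A 0).mul (B 1)).mul (C 2)).sub (((A 0).mul (C 1)).mul (B 2))).sub
    (((B 0).mul (A 1)).mul (C 2))).add (((B 0).mul (C 1)).mul (A 2))).add
    (((C 0).mul (A 1)).mul (B 2))).sub (((C 0).mul (B 1)).mul (A 2)))

/-! ### The determinant of the coordinate frame -/

/-- The determinant of the coordinate frame. -/
def frameDet (G : ℂ → C3) (z : ℂ) : ℂ := (coordFrame G z).det

/-- The factor `I / 2` is the determinant of the passage from the real partial derivatives to the
Wirtinger derivatives. -/
lemma frameDet_eq (G : ℂ → C3) (z : ℂ) : frameDet G z =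
    ((Real.exp (-(confExp G z) / 2) : ℝ) : ℂ) ^ 2 * (Complex.I / 2) *
      det3 (pd G z 1) (pd G z Complex.I) (G z) := by
  simp only [frameDet, coordFrame, det3_eq, Matrix.det_fin_three, Matrix.of_apply,
    Matrix.cons_val_zero, Matrix.cons_val_one, Matrix.cons_val, dz, dzbar, PiLp.smul_apply,
    PiLp.sub_apply, PiLp.add_apply, smul_eq_mul]
  ring

/-- Taking horizontal parts subtracts multiples of the third column. -/
lemma det3_hd (G : ℂ → C3) (z v w : ℂ) :
    det3 (hd G z v) (hd G z w) (G z) = det3 (pd G z v) (pd G z w) (G z) := by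
  simp only [det3_eq, hd, hor, PiLp.smul_apply, PiLp.sub_apply, smul_eq_mul]
  ring

lemma exp_confExp {G : ℂ → C3} {z : ℂ} (h : 0 < indMetric G z 1 1) :
    ((Real.exp (-(confExp G z) / 2) : ℝ) : ℂ) ^ 2 = 2 / (indMetric G z 1 1 : ℝ) := by
  have : Real.exp (-(confExp G z) / 2) ^ 2 = 2 / indMetric G z 1 1 := by
    rw [← Real.exp_nat_mul, confExp]
    have : ((2 : ℕ) : ℝ) * (-Real.log (indMetric G z 1 1 / 2) / 2)
        = -Real.log (indMetric G z 1 1 / 2) := by push_cast; ring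
    rw [this, Real.exp_neg, Real.exp_log (by positivity), inv_div]
  rw [← Complex.ofReal_pow, this]
  push_cast
  rfl

lemma frameDet_eq_of_pos {G : ℂ → C3} {z : ℂ} (h : 0 < indMetric G z 1 1) : frameDet G z =
    Complex.I / (indMetric G z 1 1 : ℝ) *
      det3 (hd G z 1) (hd G z Complex.I) (G z) := by
  rw [frameDet_eq, exp_confExp h, det3_hd]
  ring

lemma inner_hor {p : C3} (hp : ‖p‖ = 1) (w : C3) : inner ℂ p (hor p w) = 0 := by
  rw [hor, inner_sub_right, inner_smul_right, inner_self_eq_norm_sq_to_K, hp]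
  simp

lemma inner_hd {G : ℂ → C3} {z : ℂ} (hp : ‖G z‖ = 1) (v : ℂ) : inner ℂ (G z) (hd G z v) = 0 :=
  inner_hor hp _

lemma inner_hd_left {G : ℂ → C3} {z : ℂ} (hp : ‖G z‖ = 1) (v : ℂ) :
    inner ℂ (hd G z v) (G z) = 0 := by
  rw [← inner_conj_symm, inner_hd hp, map_zero]

lemma indMetric_self (G : ℂ → C3) (z v : ℂ) : indMetric G z v v = ‖hd G z v‖ ^ 2 := by
  rw [indMetric, inner_self_eq_norm_sq_to_K]
  norm_cast

lemma indMetric_pos {G : ℂ → C3} {z : ℂ} (h : Immersive G z) : 0 < indMetric G z 1 1 := by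
  rw [indMetric_self]
  have : hd G z 1 ≠ 0 := fun h0 => one_ne_zero (h 1 h0)
  positivity

lemma inner_hd_self (G : ℂ → C3) (z v : ℂ) :
    inner ℂ (hd G z v) (hd G z v) = ((indMetric G z v v : ℝ) : ℂ) := by
  rw [indMetric_self, inner_self_eq_norm_sq_to_K]
  norm_cast

/-- Conformality kills the real part and the Lagrangian condition the imaginary part. -/
lemma inner_hd_one_I {G : ℂ → C3} {z : ℂ} (hc : ConformalAt G z) (hl : LagrangianAt G z) :
    inner ℂ (hd G z 1) (hd G z Complex.I) = 0 :=
  Complex.ext hc.2 (hl 1 Complex.I)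

lemma inner_hd_I_one {G : ℂ → C3} {z : ℂ} (hc : ConformalAt G z) (hl : LagrangianAt G z) :
    inner ℂ (hd G z Complex.I) (hd G z 1) = 0 := by
  rw [← inner_conj_symm, inner_hd_one_I hc hl, map_zero]

/-- The pointwise conditions on a map to the sphere used for the determinant of the frame. -/
structure IsFramed (G : ℂ → C3) (z : ℂ) : Prop where
  norm : ‖G z‖ = 1
  immersive : Immersive G z
  conformal : ConformalAt G z
  lagrangian : LagrangianAt G z

lemma norm_hd_one_sq (G : ℂ → C3) (z : ℂ) :
    (‖hd G z 1‖ : ℂ) ^ 2 = (indMetric G z 1 1 : ℝ) := by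
  rw [indMetric_self]
  norm_cast

lemma norm_hd_I_sq {G : ℂ → C3} {z : ℂ} (hc : ConformalAt G z) :
    (‖hd G z Complex.I‖ : ℂ) ^ 2 = (indMetric G z 1 1 : ℝ) := by
  rw [hc.1, indMetric_self]
  norm_cast

/-- The Gram matrix of the three columns is diagonal, with two entries equal to the conformal factor
and one equal to `1`. -/
lemma conj_det3_hd_mul_self {G : ℂ → C3} {z : ℂ} (h : IsFramed G z) :
    conj (det3 (hd G z 1) (hd G z Complex.I) (G z)) * det3 (hd G z 1) (hd G z Complex.I) (G z) =
      ((indMetric G z 1 1 : ℝ) : ℂ) ^ 2 := by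
  rw [conj_det3_mul_det3, Matrix.det_fin_three]
  simp [inner_hd h.norm, inner_hd_left h.norm, inner_hd_one_I h.conformal h.lagrangian, h.norm,
    norm_hd_one_sq, norm_hd_I_sq h.conformal]
  ring

lemma norm_frameDet {G : ℂ → C3} {z : ℂ} (h : IsFramed G z) : ‖frameDet G z‖ = 1 := by
  have hpos := indMetric_pos h.immersive
  have h1 := conj_det3_hd_mul_self h
  rw [mul_comm, Complex.mul_conj, Complex.normSq_eq_norm_sq] at h1
  have h2 : ‖det3 (hd G z 1) (hd G z Complex.I) (G z)‖ = indMetric G z 1 1 := by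
    have : ‖det3 (hd G z 1) (hd G z Complex.I) (G z)‖ ^ 2 = indMetric G z 1 1 ^ 2 := by
      exact_mod_cast h1
    exact (pow_left_inj₀ (norm_nonneg _) hpos.le two_ne_zero).mp this
  rw [frameDet_eq_of_pos hpos, norm_mul, norm_div, h2, Complex.norm_I, Complex.norm_real,
    Real.norm_of_nonneg hpos.le, one_div, inv_mul_cancel₀ hpos.ne']

/-- The conjugate determinant is nonzero and can be cancelled, so a determinant is known once its
Gram determinant against the frame is. -/
lemma eq_mul_det3_hd {G : ℂ → C3} {z c d : ℂ} (h : IsFramed G z)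
    (hd' : conj (det3 (hd G z 1) (hd G z Complex.I) (G z)) * d =
      c * ((indMetric G z 1 1 : ℝ) : ℂ) ^ 2) :
    d = c * det3 (hd G z 1) (hd G z Complex.I) (G z) := by
  have hpos : ((indMetric G z 1 1 : ℝ) : ℂ) ≠ 0 := by
    exact_mod_cast (indMetric_pos h.immersive).ne'
  have h0 := conj_det3_hd_mul_self h
  have hne : conj (det3 (hd G z 1) (hd G z Complex.I) (G z)) ≠ 0 := by
    intro h'
    rw [h', zero_mul] at h0
    exact pow_ne_zero 2 hpos h0.symm
  apply mul_left_cancel₀ hne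
  linear_combination hd' - c * h0

/-- Cramer's rule in an orthogonal frame: when a column is replaced, only the component along the
replaced vector contributes. The next two lemmas treat the other columns. -/
lemma det3_first {G : ℂ → C3} {z : ℂ} (h : IsFramed G z) (x : C3) :
    det3 x (hd G z Complex.I) (G z) = inner ℂ (hd G z 1) x / (indMetric G z 1 1 : ℝ) *
      det3 (hd G z 1) (hd G z Complex.I) (G z) := by
  have hpos : ((indMetric G z 1 1 : ℝ) : ℂ) ≠ 0 := by
    exact_mod_cast (indMetric_pos h.immersive).ne'
  apply eq_mul_det3_hd h
  rw [conj_det3_mul_det3, Matrix.det_fin_three]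
  simp [inner_hd h.norm, inner_hd_left h.norm, inner_hd_one_I h.conformal h.lagrangian, h.norm,
    norm_hd_I_sq h.conformal]
  field_simp

lemma det3_second {G : ℂ → C3} {z : ℂ} (h : IsFramed G z) (x : C3) :
    det3 (hd G z 1) x (G z) = inner ℂ (hd G z Complex.I) x / (indMetric G z 1 1 : ℝ) *
      det3 (hd G z 1) (hd G z Complex.I) (G z) := by
  have hpos : ((indMetric G z 1 1 : ℝ) : ℂ) ≠ 0 := by
    exact_mod_cast (indMetric_pos h.immersive).ne'
  apply eq_mul_det3_hd h
  rw [conj_det3_mul_det3, Matrix.det_fin_three]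
  simp [inner_hd h.norm, inner_hd_left h.norm, inner_hd_I_one h.conformal h.lagrangian, h.norm,
    norm_hd_one_sq]
  field_simp

lemma det3_third {G : ℂ → C3} {z : ℂ} (h : IsFramed G z) (x : C3) :
    det3 (hd G z 1) (hd G z Complex.I) x = inner ℂ (G z) x *
      det3 (hd G z 1) (hd G z Complex.I) (G z) := by
  apply eq_mul_det3_hd h
  rw [conj_det3_mul_det3, Matrix.det_fin_three]
  simp [inner_hd h.norm, inner_hd_one_I h.conformal h.lagrangian,
    inner_hd_I_one h.conformal h.lagrangian, norm_hd_one_sq, norm_hd_I_sq h.conformal]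
  ring

/-! ### Smoothness -/

lemma ContDiffAt.pd {G : ℂ → C3} {z : ℂ} (hG : ContDiffAt ℝ ∞ G z) (v : ℂ) :
    ContDiffAt ℝ ∞ (fun ζ => pd G ζ v) z :=
  (hG.fderiv_right (m := ∞) (by simp)).clm_apply contDiffAt_const

lemma ContDiffAt.hd {G : ℂ → C3} {z : ℂ} (hG : ContDiffAt ℝ ∞ G z) (v : ℂ) :
    ContDiffAt ℝ ∞ (fun ζ => hd G ζ v) z :=
  (ContDiffAt.pd hG v).sub ((hG.inner ℂ (ContDiffAt.pd hG v)).smul hG)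

lemma ContDiffAt.indMetric {G : ℂ → C3} {z : ℂ} (hG : ContDiffAt ℝ ∞ G z) (v w : ℂ) :
    ContDiffAt ℝ ∞ (fun ζ => indMetric G ζ v w) z :=
  Complex.reCLM.contDiff.contDiffAt.comp z
    ((ContDiffAt.hd hG v).inner ℂ (ContDiffAt.hd hG w))

lemma frameDet_eventuallyEq {G : ℂ → C3} {z : ℂ} (h : ∀ᶠ ζ in 𝓝 z, IsFramed G ζ) :
    frameDet G =ᶠ[𝓝 z] fun ζ => Complex.I / (indMetric G ζ 1 1 : ℝ) *
      det3 (hd G ζ 1) (hd G ζ Complex.I) (G ζ) :=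
  h.mono fun _ hζ => frameDet_eq_of_pos (indMetric_pos hζ.immersive)

lemma contDiffAt_frameDet {G : ℂ → C3} {z : ℂ} (hG : ContDiffAt ℝ ∞ G z)
    (h : ∀ᶠ ζ in 𝓝 z, IsFramed G ζ) : ContDiffAt ℝ ∞ (frameDet G) z := by
  refine ContDiffAt.congr_of_eventuallyEq ?_ (frameDet_eventuallyEq h)
  simp only [div_eq_mul_inv]
  refine ContDiffAt.mul (ContDiffAt.mul contDiffAt_const <| ContDiffAt.inv
    (Complex.ofRealCLM.contDiff.contDiffAt.comp z (ContDiffAt.indMetric hG 1 1)) ?_)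
    (contDiffAt_det3 (ContDiffAt.hd hG _) (ContDiffAt.hd hG _) hG)
  exact_mod_cast (indMetric_pos h.self_of_nhds.immersive).ne'

/-! ### The logarithmic derivative of the determinant of the frame -/

lemma fderiv_pd_comm {G : ℂ → C3} {z : ℂ} (hG : ContDiffAt ℝ ∞ G z) (v w : ℂ) :
    fderiv ℝ (fun ζ => pd G ζ w) z v = fderiv ℝ (fun ζ => pd G ζ v) z w := by
  have h : DifferentiableAt ℝ (fderiv ℝ G) z :=
    (hG.fderiv_right (m := ∞) (by simp)).differentiableAt (by simp)
  have key (a b : ℂ) : fderiv ℝ (fun ζ => pd G ζ a) z b = fderiv ℝ (fderiv ℝ G) z b a := by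
    have : HasFDerivAt (fun ζ => pd G ζ a) _ z := h.hasFDerivAt.clm_apply (hasFDerivAt_const a z)
    rw [this.fderiv]
    simp
  rw [key, key]
  exact (hG.isSymmSndFDerivAt (by
    simp only [minSmoothness_of_isRCLikeNormedField]
    exact WithTop.coe_le_coe.mpr (le_top : (2 : ℕ∞) ≤ ⊤))).eq v w

/-! ### Horizontal projection and covariant derivative -/

lemma hor_add (p a b : C3) : hor p (a + b) = hor p a + hor p b := by
  simp only [hor, inner_add_right, add_smul]
  abel

lemma hor_smul (p : C3) (c : ℂ) (a : C3) : hor p (c • a) = c • hor p a := by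
  simp only [hor, inner_smul_right, smul_sub, smul_smul]

lemma hor_sub (p a b : C3) : hor p (a - b) = hor p a - hor p b := by
  simp only [hor, inner_sub_right, sub_smul]
  abel

lemma hor_self {p : C3} (hp : ‖p‖ = 1) : hor p p = 0 := by
  rw [hor, inner_self_eq_norm_sq_to_K, hp]
  simp

lemma hor_hor {p : C3} (hp : ‖p‖ = 1) (a : C3) : hor p (hor p a) = hor p a := by
  rw [hor, inner_hor hp, zero_smul, sub_zero]

lemma inner_hor_right {p a : C3} (h : inner ℂ a p = 0) (w : C3) :
    inner ℂ a (hor p w) = inner ℂ a w := by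
  rw [hor, inner_sub_right, inner_smul_right, h, mul_zero, sub_zero]

lemma differentiableAt_pd {G : ℂ → C3} {z : ℂ} (hG : ContDiffAt ℝ ∞ G z) (v : ℂ) :
    DifferentiableAt ℝ (fun ζ => pd G ζ v) z :=
  (ContDiffAt.pd hG v).differentiableAt (by simp)

lemma differentiableAt_hd {G : ℂ → C3} {z : ℂ} (hG : ContDiffAt ℝ ∞ G z) (v : ℂ) :
    DifferentiableAt ℝ (fun ζ => hd G ζ v) z :=
  (ContDiffAt.hd hG v).differentiableAt (by simp)

/-- In the product rule for `⟨G, G_w⟩ • G`, the derivative of the coefficient multiplies `G z`,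
which the projection kills. -/
lemma hor_fderiv_hd {G : ℂ → C3} {z : ℂ} (hG : ContDiffAt ℝ ∞ G z) (hn : ‖G z‖ = 1) (v w : ℂ) :
    hor (G z) (fderiv ℝ (fun ζ => hd G ζ w) z v) =
      hor (G z) (fderiv ℝ (fun ζ => pd G ζ w) z v) - inner ℂ (G z) (pd G z w) • hd G z v := by
  have hG' : DifferentiableAt ℝ G z := hG.differentiableAt (by simp)
  have h1 : HasFDerivAt (fun ζ => hd G ζ w) _ z :=
    (differentiableAt_pd hG w).hasFDerivAt.sub
      ((hG'.inner ℂ (differentiableAt_pd hG w)).hasFDerivAt.smul hG'.hasFDerivAt)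
  rw [h1.fderiv]
  simp only [sub_apply, add_apply,
    smul_apply, ContinuousLinearMap.smulRight_apply, hor_sub, hor_add, hor_smul,
    hor_self hn, smul_zero, add_zero]
  rfl

/-- The Levi-Civita connection is torsion free. -/
lemma covDeriv_comm {G : ℂ → C3} {z : ℂ} (hG : ContDiffAt ℝ ∞ G z) (hn : ‖G z‖ = 1) (v w : ℂ) :
    covDeriv G z v w = covDeriv G z w v := by
  have hh (x : ℂ) : hor (G z) (hd G z x) = hd G z x := hor_hor hn _
  -- The second derivative of `G` is symmetric, and the two correction terms, one from
  -- `hor_fderiv_hd` and one from the definition, are exchanged when `v` and `w` are.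
  simp only [covDeriv, hor_sub, hor_smul, hh, hor_fderiv_hd hG hn, fderiv_pd_comm hG v w]
  abel

/-- The inner product of a horizontal vector with the covariant derivative. -/
lemma inner_hd_covDeriv {G : ℂ → C3} {z : ℂ} (hn : ‖G z‖ = 1) (v w x : ℂ) :
    inner ℂ (hd G z x) (covDeriv G z v w) = inner ℂ (hd G z x) (fderiv ℝ (fun ζ => hd G ζ w) z v)
      - inner ℂ (G z) (pd G z v) * inner ℂ (hd G z x) (hd G z w) := by
  rw [covDeriv, inner_hor_right (inner_hd_left hn x), inner_sub_right, inner_smul_right]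

lemma hasDerivAt_line {E : Type*} [NormedAddCommGroup E] [NormedSpace ℝ E] {A : ℂ → E} {z : ℂ}
    (hA : DifferentiableAt ℝ A z) (v : ℂ) :
    HasDerivAt (fun t : ℝ => A (z + t • v)) (fderiv ℝ A z v) 0 := by
  have h1 : HasDerivAt (fun t : ℝ => z + t • v) v 0 := by
    simpa using ((hasDerivAt_id (0 : ℝ)).smul_const v).const_add z
  have h2 : HasFDerivAt A (fderiv ℝ A z) (z + (0 : ℝ) • v) := by simpa using hA.hasFDerivAt
  exact h2.comp_hasDerivAt (0 : ℝ) h1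

lemma eventually_line {p : ℂ → Prop} {z : ℂ} (h : ∀ᶠ ζ in 𝓝 z, p ζ) (v : ℂ) :
    ∀ᶠ t in 𝓝 (0 : ℝ), p (z + t • v) := by
  have : Filter.Tendsto (fun t : ℝ => z + t • v) (𝓝 0) (𝓝 z) := by
    have : Continuous fun t : ℝ => z + t • v := by fun_prop
    simpa using this.tendsto 0
  exact this.eventually h

lemma fderiv_inner_hd {G : ℂ → C3} {z : ℂ} (hG : ContDiffAt ℝ ∞ G z) (v w x : ℂ) :
    HasDerivAt (fun t : ℝ => (inner ℂ (hd G (z + t • v) w) (hd G (z + t • v) x) : ℂ))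
      (inner ℂ (hd G z w) (fderiv ℝ (fun ζ => hd G ζ x) z v) +
        inner ℂ (fderiv ℝ (fun ζ => hd G ζ w) z v) (hd G z x)) 0 := by
  simpa using (hasDerivAt_line (differentiableAt_hd hG w) v).inner ℂ
    (hasDerivAt_line (differentiableAt_hd hG x) v)

/-- The derivative of the induced metric. -/
lemma hasDerivAt_indMetric {G : ℂ → C3} {z : ℂ} (hG : ContDiffAt ℝ ∞ G z) (v w : ℂ) :
    HasDerivAt (fun t : ℝ => indMetric G (z + t • v) w w)
      (2 * (inner ℂ (hd G z w) (fderiv ℝ (fun ζ => hd G ζ w) z v)).re) 0 := by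
  refine ((Complex.reCLM.hasFDerivAt.comp_hasDerivAt (0 : ℝ)
    (fderiv_inner_hd hG v w w))).congr_deriv ?_
  rw [← inner_conj_symm (fderiv ℝ (fun ζ => hd G ζ w) z v), Complex.reCLM_apply, Complex.add_re,
    Complex.conj_re]
  ring

/-- The cubic form of a Lagrangian immersion is symmetric. -/
lemma im_inner_covDeriv_symm {G : ℂ → C3} {z : ℂ} (hG : ContDiffAt ℝ ∞ G z)
    (h : ∀ᶠ ζ in 𝓝 z, IsFramed G ζ) (v w x : ℂ) :
    (inner ℂ (hd G z w) (covDeriv G z v x)).im = (inner ℂ (hd G z x) (covDeriv G z v w)).im := by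
  have hn := h.self_of_nhds.norm
  have hl := h.self_of_nhds.lagrangian
  -- Differentiate the identity that the pulled back Kähler form vanishes, along the line in the
  -- direction `v`.
  have h1 : HasDerivAt (fun t : ℝ => indKahler G (z + t • v) w x) _ 0 :=
    Complex.imCLM.hasFDerivAt.comp_hasDerivAt (0 : ℝ) (fderiv_inner_hd hG v w x)
  have h2 : (fun t : ℝ => indKahler G (z + t • v) w x) =ᶠ[𝓝 0] fun _ => 0 :=
    (eventually_line h v).mono fun t ht => ht.lagrangian w x
  have h3 := h1.unique ((hasDerivAt_const (0 : ℝ) (0 : ℝ)).congr_of_eventuallyEq h2)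
  rw [← inner_conj_symm (fderiv ℝ (fun ζ => hd G ζ w) z v)] at h3
  simp only [Complex.imCLM_apply, Complex.add_im, Complex.conj_im] at h3
  rw [inner_hd_covDeriv hn, inner_hd_covDeriv hn]
  have hl1 : (inner ℂ (hd G z w) (hd G z x)).im = 0 := hl w x
  -- This product is real, hence symmetric, so the vertical corrections on both sides agree.
  have h4 : inner ℂ (hd G z x) (hd G z w) = (inner ℂ (hd G z w) (hd G z x) : ℂ) := by
    rw [← inner_conj_symm]
    exact Complex.conj_eq_iff_im.mpr hl1
  rw [h4]
  simp only [Complex.sub_im]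
  linarith

/-- The mean curvature form of a minimal Lagrangian immersion vanishes. -/
lemma im_inner_covDeriv_add {G : ℂ → C3} {z : ℂ}
    (h : ∀ᶠ ζ in 𝓝 z, IsFramed G ζ) (hm : MeanCurvatureZero G z) (v : ℂ) :
    (inner ℂ (hd G z v) (covDeriv G z 1 1)).im +
      (inner ℂ (hd G z v) (covDeriv G z Complex.I Complex.I)).im = 0 := by
  have h0 := h.self_of_nhds
  have hn := h0.norm
  have hpos := indMetric_pos h0.immersive
  have hl (w : ℂ) : (inner ℂ (hd G z w) (hd G z v)).im = 0 := h0.lagrangian w v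
  -- For a Lagrangian immersion, multiplication by `I` sends tangent vectors to normal ones, so this
  -- is an admissible test vector.
  have h1 := hm (Complex.I • hd G z v)
    (by rw [inner_smul_right, inner_hd hn, mul_zero])
    (by rw [inner_smul_right, Complex.I_mul_re, hl, neg_zero])
    (by rw [inner_smul_right, Complex.I_mul_re, hl, neg_zero])
  rw [inner_smul_right, Complex.I_mul_re, neg_eq_zero, ← inner_conj_symm, Complex.conj_im,
    neg_eq_zero, traceHess, h0.conformal.2, ← h0.conformal.1, zero_smul, sub_zero, ← smul_add,
    inner_smul_right_eq_smul, inner_add_right, Complex.smul_im, Complex.add_im,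
    smul_eq_mul] at h1
  exact (mul_eq_zero.mp h1).resolve_left hpos.ne'

/-- The sum of the diagonal entries of the connection form. -/
lemma im_inner_covDeriv_trace {G : ℂ → C3} {z : ℂ} (hG : ContDiffAt ℝ ∞ G z)
    (h : ∀ᶠ ζ in 𝓝 z, IsFramed G ζ) (hm : MeanCurvatureZero G z) (v : ℂ) :
    (inner ℂ (hd G z 1) (covDeriv G z v 1)).im +
      (inner ℂ (hd G z Complex.I) (covDeriv G z v Complex.I)).im = 0 := by
  have hn := h.self_of_nhds.norm
  -- Torsion-freeness and the symmetry of the cubic form make it totally symmetric, so `v` can be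
  -- moved to the first slot, leaving the mean curvature form.
  have key (w : ℂ) : (inner ℂ (hd G z w) (covDeriv G z v w)).im =
      (inner ℂ (hd G z v) (covDeriv G z w w)).im := by
    rw [covDeriv_comm hG hn, im_inner_covDeriv_symm hG h]
  rw [key, key]
  exact im_inner_covDeriv_add h hm v

lemma re_inner_pd {G : ℂ → C3} {z : ℂ} (hG : DifferentiableAt ℝ G z)
    (h : ∀ᶠ ζ in 𝓝 z, ‖G ζ‖ = 1) (v : ℂ) : (inner ℂ (G z) (pd G z v)).re = 0 := by
  have h1 := (hasDerivAt_line hG v).inner ℂ (hasDerivAt_line hG v)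
  have h2 : (fun t : ℝ => (inner ℂ (G (z + t • v)) (G (z + t • v)) : ℂ)) =ᶠ[𝓝 0] fun _ => 1 :=
    (eventually_line h v).mono fun t ht => by
      simp only
      rw [inner_self_eq_norm_sq_to_K, ht]
      simp
  have h3 := h1.unique ((hasDerivAt_const (0 : ℝ) (1 : ℂ)).congr_of_eventuallyEq h2)
  have h4 := congrArg Complex.re h3
  simp only [zero_smul, add_zero] at h4
  rw [← inner_conj_symm (fderiv ℝ G z v)] at h4
  simp only [Complex.add_re, Complex.conj_re, Complex.zero_re] at h4
  rw [pd]
  linarith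

/-- For a minimal Lagrangian immersion, the logarithmic derivative of the determinant of the frame
of a lift is three times the connection form of the lift. -/
theorem fderiv_frameDet {G : ℂ → C3} {z : ℂ} (hG : ContDiffAt ℝ ∞ G z)
    (h : ∀ᶠ ζ in 𝓝 z, IsFramed G ζ) (hm : MeanCurvatureZero G z) (v : ℂ) :
    fderiv ℝ (frameDet G) z v = 3 * inner ℂ (G z) (pd G z v) * frameDet G z := by
  have h0 := h.self_of_nhds
  have hn := h0.norm
  have hpos := indMetric_pos h0.immersive
  have hpos' : ((indMetric G z 1 1 : ℝ) : ℂ) ≠ 0 := by exact_mod_cast hpos.ne'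
  have hG' : DifferentiableAt ℝ G z := hG.differentiableAt (by simp)
  have h1 := hasDerivAt_line ((contDiffAt_frameDet hG h).differentiableAt (by simp)) v
  have hA := hasDerivAt_indMetric hG v 1
  have hdet := hasDerivAt_det3 (hasDerivAt_line (differentiableAt_hd hG 1) v)
    (hasDerivAt_line (differentiableAt_hd hG Complex.I) v) (hasDerivAt_line hG' v)
  have hq := ((hasDerivAt_const (0 : ℝ) Complex.I).div hA.ofReal_comp
    (by simpa using hpos')).mul hdet
  have h2 := h1.unique (hq.congr_of_eventuallyEq (eventually_line (frameDet_eventuallyEq h) v))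
  have hB := hasDerivAt_indMetric hG v Complex.I
  -- Both sides are half the derivative of the conformal factor, computed from either coordinate
  -- vector.
  have hAB : (inner ℂ (hd G z 1) (fderiv ℝ (fun ζ => hd G ζ 1) z v)).re =
      (inner ℂ (hd G z Complex.I) (fderiv ℝ (fun ζ => hd G ζ Complex.I) z v)).re := by
    have := hA.unique (hB.congr_of_eventuallyEq
      ((eventually_line h v).mono fun t ht => ht.conformal.1))
    linarith
  have him := im_inner_covDeriv_trace hG h hm v
  rw [inner_hd_covDeriv hn, inner_hd_covDeriv hn, inner_hd_self, inner_hd_self,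
    ← h0.conformal.1] at him
  have hre := re_inner_pd hG' (h.mono fun _ h => h.norm) v
  rw [h2, frameDet_eq_of_pos hpos]
  simp only [Pi.div_apply, zero_smul, add_zero]
  rw [det3_first h0 (fderiv ℝ (fun ζ => hd G ζ 1) z v),
    det3_second h0 (fderiv ℝ (fun ζ => hd G ζ Complex.I) z v), det3_third h0 (fderiv ℝ G z v)]
  set a := (inner ℂ (hd G z 1) (fderiv ℝ (fun ζ => hd G ζ 1) z v) : ℂ)
  set b := (inner ℂ (hd G z Complex.I) (fderiv ℝ (fun ζ => hd G ζ Complex.I) z v) : ℂ)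
  have hmu : inner ℂ (G z) (fderiv ℝ G z v) = (inner ℂ (G z) (pd G z v) : ℂ) := rfl
  rw [hmu]
  set μ := (inner ℂ (G z) (pd G z v) : ℂ)
  -- With `g` the conformal factor, the logarithmic derivative is `-2 Re a / g + (a + b) / g + μ`.
  -- The real part of this identity is conformality with `Re μ = 0`; the imaginary part is
  -- minimality. The total is `3 μ`.
  have hab : a + b - 2 * a.re - 2 * μ * (indMetric G z 1 1 : ℝ) = 0 := by
    apply Complex.ext
    · simp [hre, ← hAB]; ring
    · simp at him ⊢
      linarith
  have hab' : a + b = 2 * a.re + 2 * μ * (indMetric G z 1 1 : ℝ) := by linear_combination hab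
  clear_value a b μ
  generalize det3 (hd G z 1) (hd G z Complex.I) (G z) = d
  generalize ((indMetric G z 1 1 : ℝ) : ℂ) = l at hpos' hab' ⊢
  push_cast
  field_simp
  linear_combination (Complex.I * d) * hab'

/-! ### Change of the lift and of the coordinate -/

/-- The determinant depends only on the value and first derivative of the map at the point. -/
lemma frameDet_congr {G H : ℂ → C3} {z : ℂ} (h : G =ᶠ[𝓝 z] H) : frameDet G z = frameDet H z := by
  have h1 : fderiv ℝ G z = fderiv ℝ H z := h.fderiv_eq
  have h2 : G z = H z := h.self_of_nhds
  simp only [frameDet_eq, confExp, indMetric, hd, pd, h1, h2]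

section Gauge

variable {G : ℂ → C3} {k : ℂ → ℂ} {z : ℂ}

lemma pd_smul (hG : DifferentiableAt ℝ G z) (hk : DifferentiableAt ℝ k z) (v : ℂ) :
    pd (fun ζ => k ζ • G ζ) z v = k z • pd G z v + fderiv ℝ k z v • G z := by
  have : HasFDerivAt (fun ζ => k ζ • G ζ) _ z := hk.hasFDerivAt.smul hG.hasFDerivAt
  rw [pd, this.fderiv]
  rfl

lemma hor_smul_left {c : ℂ} (hc : ‖c‖ = 1) (p w : C3) : hor (c • p) w = hor p w := by
  have : c * conj c = 1 := by rw [Complex.mul_conj, Complex.normSq_eq_norm_sq, hc]; simp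
  rw [hor, hor, inner_smul_left, smul_smul, mul_right_comm, mul_comm (conj c), this, one_mul]

lemma hd_smul (hG : DifferentiableAt ℝ G z) (hk : DifferentiableAt ℝ k z) (hn : ‖G z‖ = 1)
    (hk1 : ‖k z‖ = 1) (v : ℂ) : hd (fun ζ => k ζ • G ζ) z v = k z • hd G z v := by
  rw [hd, pd_smul hG hk, hor_smul_left hk1, hor_add, hor_smul, hor_smul, hor_self hn, smul_zero,
    add_zero, hd]

lemma indMetric_smul (hG : DifferentiableAt ℝ G z) (hk : DifferentiableAt ℝ k z) (hn : ‖G z‖ = 1)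
    (hk1 : ‖k z‖ = 1) (v w : ℂ) :
    indMetric (fun ζ => k ζ • G ζ) z v w = indMetric G z v w := by
  have : conj (k z) * k z = 1 := by
    rw [mul_comm, Complex.mul_conj, Complex.normSq_eq_norm_sq, hk1]; simp
  rw [indMetric, hd_smul hG hk hn hk1, hd_smul hG hk hn hk1, inner_smul_left, inner_smul_right,
    ← mul_assoc, this, one_mul, indMetric]

/-- The determinant of the frame is multiplied by the cube of the gauge. -/
lemma frameDet_smul (hG : DifferentiableAt ℝ G z) (hk : DifferentiableAt ℝ k z) (hn : ‖G z‖ = 1)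
    (hk1 : ‖k z‖ = 1) : frameDet (fun ζ => k ζ • G ζ) z = k z ^ 3 * frameDet G z := by
  rw [frameDet_eq, frameDet_eq, confExp, indMetric_smul hG hk hn hk1, confExp, pd_smul hG hk,
    pd_smul hG hk]
  simp only [det3_eq, PiLp.smul_apply, PiLp.add_apply, smul_eq_mul]
  ring

end Gauge

section Coordinate

variable {G : ℂ → C3} {φ : ℂ → ℂ} {φ' z : ℂ}

lemma pd_comp (hG : DifferentiableAt ℝ G (φ z)) (hφ : HasDerivAt φ φ' z) (v : ℂ) :
    pd (G ∘ φ) z v = pd G (φ z) (φ' * v) := by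
  have h1 : HasFDerivAt φ _ z := hφ.hasFDerivAt.restrictScalars ℝ
  have h2 := (hG.hasFDerivAt.comp z h1).fderiv
  rw [pd, h2, pd]
  simp [mul_comm]

lemma pd_eq (G : ℂ → C3) (z v : ℂ) : pd G z v = v.re • pd G z 1 + v.im • pd G z Complex.I := by
  have : v = v.re • (1 : ℂ) + v.im • Complex.I := by simp
  conv_lhs => rw [this]
  simp only [pd, map_add, map_smul]

lemma hd_eq (G : ℂ → C3) (z v : ℂ) : hd G z v = v.re • hd G z 1 + v.im • hd G z Complex.I := by
  rw [hd, pd_eq, hor_add, ← Complex.coe_smul, ← Complex.coe_smul, hor_smul, hor_smul,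
    Complex.coe_smul, Complex.coe_smul, hd, hd]

lemma hd_comp (hG : DifferentiableAt ℝ G (φ z)) (hφ : HasDerivAt φ φ' z) (v : ℂ) :
    hd (G ∘ φ) z v = hd G (φ z) (φ' * v) := by
  rw [hd, pd_comp hG hφ, hd, comp_apply]

lemma indMetric_of_conformal (hc : ConformalAt G z) (v : ℂ) :
    indMetric G z v v = ‖v‖ ^ 2 * indMetric G z 1 1 := by
  have h1 := hc.1
  have h2 := hc.2
  have h3 : (inner ℂ (hd G z Complex.I) (hd G z 1)).re = 0 := by
    rw [← inner_conj_symm, Complex.conj_re]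
    exact h2
  rw [← Complex.normSq_eq_norm_sq, Complex.normSq_apply]
  rw [indMetric, hd_eq]
  simp only [inner_add_left, inner_add_right, Complex.add_re, ← Complex.coe_smul, inner_smul_left,
    inner_smul_right, Complex.conj_ofReal, Complex.re_ofReal_mul, h3]
  simp only [indMetric] at h1 h2 ⊢
  rw [h2, ← h1]
  ring

/-- The determinant of the frame does not depend on the holomorphic coordinate. -/
lemma frameDet_comp (hG : DifferentiableAt ℝ G (φ z)) (hφ : HasDerivAt φ φ' z) (h0 : φ' ≠ 0)
    (hc : ConformalAt G (φ z)) (hpos : 0 < indMetric G (φ z) 1 1) :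
    frameDet (G ∘ φ) z = frameDet G (φ z) := by
  have hm : indMetric (G ∘ φ) z 1 1 = ‖φ'‖ ^ 2 * indMetric G (φ z) 1 1 := by
    rw [← indMetric_of_conformal hc, indMetric, hd_comp hG hφ, mul_one, indMetric]
  have hn : 0 < ‖φ'‖ := norm_pos_iff.mpr h0
  have hpos' : 0 < indMetric (G ∘ φ) z 1 1 := by rw [hm]; positivity
  -- Multiplication by `φ'` on `ℝ²` has determinant `‖φ'‖ ^ 2`, the factor by which the metric
  -- scales; the two cancel.
  have hdet : det3 (pd (G ∘ φ) z 1) (pd (G ∘ φ) z Complex.I) ((G ∘ φ) z) =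
      ((‖φ'‖ ^ 2 : ℝ) : ℂ) * det3 (pd G (φ z) 1) (pd G (φ z) Complex.I) (G (φ z)) := by
    rw [pd_comp hG hφ, pd_comp hG hφ, pd_eq, pd_eq G (φ z) (φ' * Complex.I),
      ← Complex.normSq_eq_norm_sq, Complex.normSq_apply, comp_apply]
    simp [det3_eq]
    ring
  rw [frameDet_eq, frameDet_eq, exp_confExp hpos, exp_confExp hpos', hm, hdet]
  have h1 : ((‖φ'‖ : ℝ) : ℂ) ≠ 0 := by exact_mod_cast hn.ne'
  have h2 : ((indMetric G (φ z) 1 1 : ℝ) : ℂ) ≠ 0 := by exact_mod_cast hpos.ne'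
  push_cast
  field_simp

end Coordinate

/-! ### Injective holomorphic functions -/

/-- The derivative of a holomorphic homeomorphism between open sets of `ℂ` does not vanish. -/
lemma deriv_ne_zero_of_openPartialHomeomorph (φ : OpenPartialHomeomorph ℂ ℂ)
    (hd : DifferentiableOn ℂ φ φ.source) {z : ℂ} (hz : z ∈ φ.source) : deriv φ z ≠ 0 := by
  have han : AnalyticOnNhd ℂ φ φ.source := hd.analyticOnNhd φ.open_source
  have hsrc : φ.source ∈ 𝓝 z := φ.open_source.mem_nhds hz
  have hinv (w : ℂ) (hw : w ∈ φ.source) (h0 : deriv φ w ≠ 0) :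
      DifferentiableAt ℂ φ.symm (φ w) := by
    have h1 : HasDerivAt φ (deriv φ w) (φ.symm (φ w)) := by
      rw [φ.left_inv hw]
      exact (han w hw).differentiableAt.hasDerivAt
    exact (φ.hasDerivAt_symm (φ.map_source hw) h0 h1).differentiableAt
  -- Either the derivative vanishes near `z`, and then the map is constant on a ball, against
  -- injectivity; or `z` is at most an isolated zero. In the latter case the inverse is holomorphic
  -- off `φ z` and continuous there, so the singularity is removable and the chain rule applies.
  rcases (han z hz).deriv.eventually_eq_zero_or_eventually_ne_zero with h | h
  · exfalso
    obtain ⟨r, hr, hball⟩ := Metric.eventually_nhds_iff_ball.mp (h.and hsrc)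
    have hconst : ∀ w ∈ Metric.ball z r, φ w = φ z := by
      intro w hw
      refine (Metric.isOpen_ball).is_const_of_deriv_eq_zero
        (convex_ball z r).isPreconnected ?_ ?_ hw (Metric.mem_ball_self hr)
      · exact hd.mono fun w hw => (hball w hw).2
      · exact fun w hw => (hball w hw).1
    have hmem : z + (r / 2 : ℝ) ∈ Metric.ball z r := by
      rw [mem_ball_iff_norm, add_sub_cancel_left, Complex.norm_real,
        Real.norm_of_nonneg (by linarith)]
      linarith
    have := φ.injOn (hball _ hmem).2 hz (hconst _ hmem)
    rw [add_eq_left] at this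
    exact (half_pos hr).ne' (by exact_mod_cast this)
  · have hmem : φ z ∈ φ.target := φ.map_source hz
    have hsymm : ∀ᶠ w in 𝓝[≠] (φ z), DifferentiableAt ℂ φ.symm w := by
      have h1 : Filter.Tendsto φ.symm (𝓝[≠] (φ z)) (𝓝[≠] z) := by
        refine tendsto_nhdsWithin_iff.mpr ⟨?_, ?_⟩
        · have := (φ.continuousAt_symm hmem).tendsto
          rw [φ.left_inv hz] at this
          exact this.mono_left nhdsWithin_le_nhds
        · filter_upwards [self_mem_nhdsWithin,
            nhdsWithin_le_nhds (φ.open_target.mem_nhds hmem)] with w hw hw' hww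
          apply hw
          rw [mem_singleton_iff] at hww ⊢
          rw [← hww, φ.right_inv hw']
      filter_upwards [h1.eventually h,
        nhdsWithin_le_nhds (φ.open_target.mem_nhds hmem)] with w hw hw'
      have := hinv (φ.symm w) (φ.map_target hw') hw
      rwa [φ.right_inv hw'] at this
    have hz' : DifferentiableAt ℂ φ.symm (φ z) :=
      (Complex.analyticAt_of_differentiable_on_punctured_nhds_of_continuousAt hsymm
        (φ.continuousAt_symm hmem)).differentiableAt
    intro h0
    have h1 : HasDerivAt (φ.symm ∘ φ) (deriv φ.symm (φ z) * deriv φ z) z :=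
      hz'.hasDerivAt.comp z (han z hz).differentiableAt.hasDerivAt
    have h2 : HasDerivAt (φ.symm ∘ φ) 1 z := by
      refine (hasDerivAt_id z).congr_of_eventuallyEq ?_
      filter_upwards [hsrc] with w hw using φ.left_inv hw
    have := h1.unique h2
    rw [h0, mul_zero] at this
    exact zero_ne_one this

/-! ### Riemann surfaces as real manifolds, étale maps -/

section Etale

variable {X M : Type*} [TopologicalSpace X] [ChartedSpace ℂ X] [TopologicalSpace M]
  [ChartedSpace ℂ M]

lemma isManifold_real (h : IsManifold 𝓘(ℂ) ω X) : IsManifold 𝓘(ℝ, ℂ) ∞ X := by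
  refine isManifold_of_contDiffOn _ _ _ fun e e' he he' => ?_
  have h1 := (mem_groupoid_of_pregroupoid.mp
    (h.compatible he he' : e.symm ≫ₕ e' ∈ contDiffGroupoid ω 𝓘(ℂ))).1
  exact (ContDiffOn.restrict_scalars ℝ h1).of_le le_top

/-- A holomorphic local homeomorphism. -/
structure IsEtale (q : X → M) : Prop where
  holomorphic : MDifferentiable 𝓘(ℂ) 𝓘(ℂ) q
  isLocalHomeomorph : IsLocalHomeomorph q

lemma isEtale_id : IsEtale (id : M → M) :=
  ⟨mdifferentiable_id, (Homeomorph.refl M).isLocalHomeomorph⟩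

lemma IsHolomorphicCovering.isEtale {q : X → M} (h : IsHolomorphicCovering q) : IsEtale q :=
  ⟨h.holomorphic, h.covering.isLocalHomeomorph⟩

/-- Restricting the coordinate expression of `q` to a domain where `q` is injective puts it in the
form required by `deriv_ne_zero_of_openPartialHomeomorph`. -/
lemma IsEtale.exists_openPartialHomeomorph {q : X → M} (hq : IsEtale q)
    (hX : IsManifold 𝓘(ℂ) ω X) (hM : IsManifold 𝓘(ℂ) ω M)
    {e : OpenPartialHomeomorph X ℂ} (he : e ∈ atlas ℂ X) {e₀ : OpenPartialHomeomorph M ℂ}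
    (he₀ : e₀ ∈ atlas ℂ M) {x : X} (hx : x ∈ e.source) (hqx : q x ∈ e₀.source) :
    ∃ φ : OpenPartialHomeomorph ℂ ℂ, (φ : ℂ → ℂ) = e₀ ∘ q ∘ e.symm ∧ e x ∈ φ.source ∧
      DifferentiableOn ℂ φ φ.source := by
  have : IsManifold 𝓘(ℂ) 1 X := IsManifold.of_le le_top
  have : IsManifold 𝓘(ℂ) 1 M := IsManifold.of_le le_top
  obtain ⟨s, hs, rfl⟩ := hq.isLocalHomeomorph x
  refine ⟨e.symm ≫ₕ s ≫ₕ e₀, by simp [comp_assoc], by simp [hx, hs, hqx], fun z hz => ?_⟩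
  simp only [OpenPartialHomeomorph.trans_source, OpenPartialHomeomorph.symm_source, mem_inter_iff,
    mem_preimage] at hz
  have h1 : MDifferentiableAt 𝓘(ℂ) 𝓘(ℂ) (e₀ ∘ s ∘ e.symm) z :=
    (mdifferentiableAt_atlas he₀ hz.2.2).comp z
      ((hq.holomorphic _).comp z (mdifferentiableAt_atlas_symm he hz.1))
  exact h1.differentiableAt.differentiableWithinAt

lemma IsEtale.coord {q : X → M} (hq : IsEtale q)
    (hX : IsManifold 𝓘(ℂ) ω X) (hM : IsManifold 𝓘(ℂ) ω M)
    {e : OpenPartialHomeomorph X ℂ} (he : e ∈ atlas ℂ X) {e₀ : OpenPartialHomeomorph M ℂ}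
    (he₀ : e₀ ∈ atlas ℂ M) {x : X} (hx : x ∈ e.source) (hqx : q x ∈ e₀.source) :
    AnalyticAt ℂ (e₀ ∘ q ∘ e.symm) (e x) ∧ deriv (e₀ ∘ q ∘ e.symm) (e x) ≠ 0 := by
  obtain ⟨φ, hφ, hmem, hd⟩ := hq.exists_openPartialHomeomorph hX hM he he₀ hx hqx
  rw [← hφ]
  exact ⟨hd.analyticOnNhd φ.open_source _ hmem, deriv_ne_zero_of_openPartialHomeomorph φ hd hmem⟩

lemma inChart_comp_eventuallyEq {Y N : Type*} [TopologicalSpace Y] [TopologicalSpace N]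
    {q : Y → N} (hq : Continuous q) {F : N → S5} {G : Y → S5} {x : Y} (hGF : G =ᶠ[𝓝 x] F ∘ q)
    {e : OpenPartialHomeomorph Y ℂ} {e₀ : OpenPartialHomeomorph N ℂ} (hx : x ∈ e.source)
    (hqx : q x ∈ e₀.source) :
    inChart G e =ᶠ[𝓝 (e x)] inChart F e₀ ∘ (e₀ ∘ q ∘ e.symm) := by
  have h1 : Filter.Tendsto e.symm (𝓝 (e x)) (𝓝 x) := by
    have := (e.continuousAt_symm (e.map_source hx)).tendsto
    rwa [e.left_inv hx] at this
  have h2 : ∀ᶠ y in 𝓝 x, q y ∈ e₀.source := hq.continuousAt.eventually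
    (e₀.open_source.mem_nhds hqx)
  filter_upwards [h1.eventually hGF, h1.eventually h2] with z hz hz'
  simp only [inChart, hz, comp_apply, e₀.left_inv hz']

/-- Smoothness of a map to the sphere in a chart. -/
lemma contDiffAt_inChart (hM : IsManifold 𝓘(ℂ) ω M) {U : Set M} {F : M → S5} (hU : IsOpen U)
    (hF : ContMDiffOn 𝓘(ℝ, ℂ) 𝓘(ℝ, C3) ∞ (fun x => (F x : C3)) U)
    {e : OpenPartialHomeomorph M ℂ} (he : e ∈ atlas ℂ M) {z : ℂ} (hz : z ∈ e.target)
    (hzU : e.symm z ∈ U) : ContDiffAt ℝ ∞ (inChart F e) z := by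
  have := isManifold_real hM
  have h1 : ContMDiffAt 𝓘(ℝ, ℂ) 𝓘(ℝ, ℂ) ∞ e.symm z :=
    contMDiffAt_symm_of_mem_maximalAtlas (IsManifold.subset_maximalAtlas he) hz
  have h2 := (hF.contMDiffAt (hU.mem_nhds hzU)).comp z h1
  exact h2.contDiffAt

lemma contMDiffAt_of_inChart (hM : IsManifold 𝓘(ℂ) ω M) {F : M → S5}
    {e : OpenPartialHomeomorph M ℂ} (he : e ∈ atlas ℂ M) {x : M} (hx : x ∈ e.source)
    (hF : ContDiffAt ℝ ∞ (inChart F e) (e x)) :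
    ContMDiffAt 𝓘(ℝ, ℂ) 𝓘(ℝ, C3) ∞ (fun x => (F x : C3)) x := by
  have := isManifold_real hM
  have h1 : ContMDiffAt 𝓘(ℝ, ℂ) 𝓘(ℝ, ℂ) ∞ e x :=
    contMDiffAt_of_mem_maximalAtlas (IsManifold.subset_maximalAtlas he) hx
  refine (hF.contMDiffAt.comp x h1).congr_of_eventuallyEq ?_
  filter_upwards [e.open_source.mem_nhds hx] with y hy
  simp [inChart, e.left_inv hy]

end Etale

/-! ### The Hopf fibration and the circle action -/

/-- The action of the circle on the sphere. -/
def rot (k : Circle) (v : S5) : S5 :=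
  ⟨(k : ℂ) • (v : C3), by
    rw [mem_sphere_zero_iff_norm, norm_smul, Circle.norm_coe, one_mul]
    exact mem_sphere_zero_iff_norm.mp v.2⟩

@[simp] lemma coe_rot (k : Circle) (v : S5) : (rot k v : C3) = (k : ℂ) • (v : C3) := rfl

lemma norm_S5 (v : S5) : ‖(v : C3)‖ = 1 := mem_sphere_zero_iff_norm.mp v.2

lemma S5_ne_zero (v : S5) : (v : C3) ≠ 0 := by
  intro h
  have := norm_S5 v
  rw [h, norm_zero] at this
  exact zero_ne_one this

@[simp] lemma rot_one (v : S5) : rot 1 v = v := Subtype.ext (by simp)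

lemma rot_mul (k l : Circle) (v : S5) : rot (k * l) v = rot k (rot l v) :=
  Subtype.ext (by simp [mul_smul])

lemma rot_right_cancel {k l : Circle} {v : S5} (h : rot k v = rot l v) : k = l := by
  have h1 := congrArg (fun w : S5 => (w : C3)) h
  simp only [coe_rot] at h1
  exact Circle.coe_injective (smul_left_injective ℂ (S5_ne_zero v) h1)

@[fun_prop]
lemma continuous_rot : Continuous fun y : Circle × S5 => rot y.1 y.2 := by
  refine Continuous.subtype_mk ?_ _
  fun_prop

@[simp] lemma hopf_rot (k : Circle) (v : S5) : hopf (rot k v) = hopf v := by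
  rw [hopf, hopf, Projectivization.mk_eq_mk_iff']
  exact ⟨k, rfl⟩

lemma exists_rot_of_hopf_eq {v w : S5} (h : hopf w = hopf v) : ∃ k : Circle, w = rot k v := by
  rw [hopf, hopf, Projectivization.mk_eq_mk_iff'] at h
  obtain ⟨a, ha⟩ := h
  have hn : ‖a‖ = 1 := by
    have := congrArg norm ha
    rwa [norm_smul, norm_S5, norm_S5, mul_one] at this
  exact ⟨⟨a, mem_sphere_zero_iff_norm.mpr hn⟩, Subtype.ext ha.symm⟩

lemma inner_rot (k : Circle) (v : S5) : inner ℂ (v : C3) (rot k v : C3) = (k : ℂ) := by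
  rw [coe_rot, inner_smul_right, inner_self_eq_norm_sq_to_K, norm_S5]
  simp

lemma mem_cubeRoots {k : Circle} : k ∈ cubeRoots ↔ (k : ℂ) ^ 3 = 1 := by
  rw [cubeRoots, MonoidHom.mem_ker, powMonoidHom_apply, ← Circle.coe_inj, Circle.coe_pow,
    Circle.coe_one]

/-! ### Normalized local lifts -/

section LocalLift

variable {X M : Type*} [TopologicalSpace X] [ChartedSpace ℂ X] [TopologicalSpace M]
  [ChartedSpace ℂ M]

/-- A local lift whose coordinate frame has determinant one. -/
structure IsNormLift (f : M → CP2) (U : Set M) (F : M → S5) : Prop extends IsLocalLift f U F where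
  det : ∀ e ∈ atlas ℂ M, ∀ z ∈ e.target, e.symm z ∈ U → frameDet (inChart F e) z = 1

variable {f : M → CP2} {U : Set M} {F : M → S5}

lemma IsLocalLift.continuousAt (h : IsLocalLift f U F) {x : M} (hx : x ∈ U) :
    ContinuousAt F x := by
  have := (h.smooth.continuousOn.continuousAt (h.isOpen.mem_nhds hx))
  exact IsInducing.subtypeVal.continuousAt_iff.mpr this

lemma IsMinimalLagrangianImmersion.isFramed (hf : IsMinimalLagrangianImmersion f)
    (h : IsLocalLift f U F) {e : OpenPartialHomeomorph M ℂ} (he : e ∈ atlas ℂ M) {z : ℂ}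
    (hz : z ∈ e.target) (hzU : e.symm z ∈ U) : IsFramed (inChart F e) z :=
  ⟨norm_S5 _, hf.immersive U F h e he z hz hzU, hf.conformal U F h e he z hz hzU,
    hf.lagrangian U F h e he z hz hzU⟩

lemma eventually_mem_chart {M : Type*} [TopologicalSpace M] {U : Set M} (hU : IsOpen U)
    {e : OpenPartialHomeomorph M ℂ} {z : ℂ}
    (hz : z ∈ e.target) (hzU : e.symm z ∈ U) : ∀ᶠ ζ in 𝓝 z, ζ ∈ e.target ∧ e.symm ζ ∈ U := by
  filter_upwards [e.open_target.mem_nhds hz,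
    (e.continuousAt_symm hz).eventually (hU.mem_nhds hzU)] with ζ h1 h2 using ⟨h1, h2⟩

lemma IsMinimalLagrangianImmersion.eventually_isFramed (hf : IsMinimalLagrangianImmersion f)
    (h : IsLocalLift f U F) {e : OpenPartialHomeomorph M ℂ} (he : e ∈ atlas ℂ M) {z : ℂ}
    (hz : z ∈ e.target) (hzU : e.symm z ∈ U) : ∀ᶠ ζ in 𝓝 z, IsFramed (inChart F e) ζ :=
  (eventually_mem_chart h.isOpen hz hzU).mono fun _ hζ => hf.isFramed h he hζ.1 hζ.2

/-- Lifts whose coordinate frame has determinant one are horizontal. -/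
lemma IsNormLift.horizontal (hM : IsManifold 𝓘(ℂ) ω M) (hf : IsMinimalLagrangianImmersion f)
    (h : IsNormLift f U F) {e : OpenPartialHomeomorph M ℂ} (he : e ∈ atlas ℂ M) {z : ℂ}
    (hz : z ∈ e.target) (hzU : e.symm z ∈ U) (v : ℂ) :
    inner ℂ (inChart F e z) (pd (inChart F e) z v) = 0 := by
  have h1 := fderiv_frameDet (contDiffAt_inChart hM h.isOpen h.smooth he hz hzU)
    (hf.eventually_isFramed h.toIsLocalLift he hz hzU)
    (hf.minimal U F h.toIsLocalLift e he z hz hzU) v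
  have h2 : frameDet (inChart F e) =ᶠ[𝓝 z] fun _ => 1 :=
    (eventually_mem_chart h.isOpen hz hzU).mono fun ζ hζ => h.det e he ζ hζ.1 hζ.2
  -- The determinant is constantly `1`, so its logarithmic derivative, three times the connection
  -- form, is zero.
  rw [h2.fderiv_eq, h2.self_of_nhds] at h1
  simpa using h1.symm

/-- The determinant of the frame of a local lift composed with an étale map. -/
lemma frameDet_inChart_comp (hX : IsManifold 𝓘(ℂ) ω X) (hM : IsManifold 𝓘(ℂ) ω M)
    (hf : IsMinimalLagrangianImmersion f) (h : IsLocalLift f U F) {q : X → M} (hq : IsEtale q)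
    {G : X → S5} {x : X} (hx : q x ∈ U) (hGF : G =ᶠ[𝓝 x] F ∘ q) {e : OpenPartialHomeomorph X ℂ}
    (he : e ∈ atlas ℂ X) (hxe : x ∈ e.source) {e₀ : OpenPartialHomeomorph M ℂ}
    (he₀ : e₀ ∈ atlas ℂ M) (hxe₀ : q x ∈ e₀.source) :
    frameDet (inChart G e) (e x) = frameDet (inChart F e₀) (e₀ (q x)) := by
  obtain ⟨h1, h2⟩ := hq.coord hX hM he he₀ hxe hxe₀
  have hval : (e₀ ∘ q ∘ e.symm) (e x) = e₀ (q x) := by simp [hxe]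
  have hz := e₀.map_source hxe₀
  have hzU : e₀.symm (e₀ (q x)) ∈ U := by rwa [e₀.left_inv hxe₀]
  have hfr := hf.isFramed h he₀ hz hzU
  have hsm := contDiffAt_inChart hM h.isOpen h.smooth he₀ hz hzU
  rw [frameDet_congr (inChart_comp_eventuallyEq hq.isLocalHomeomorph.continuous hGF hxe hxe₀),
    frameDet_comp (φ' := deriv (e₀ ∘ q ∘ e.symm) (e x)) _ h1.differentiableAt.hasDerivAt h2,
    hval]
  · rw [hval]; exact hfr.conformal
  · rw [hval]; exact indMetric_pos hfr.immersive
  · rw [hval]; exact hsm.differentiableAt (by simp)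

lemma contDiffAt_inChart_comp (hX : IsManifold 𝓘(ℂ) ω X) (hM : IsManifold 𝓘(ℂ) ω M)
    (h : IsLocalLift f U F) {q : X → M} (hq : IsEtale q)
    {G : X → S5} {x : X} (hx : q x ∈ U) (hGF : G =ᶠ[𝓝 x] F ∘ q) {e : OpenPartialHomeomorph X ℂ}
    (he : e ∈ atlas ℂ X) (hxe : x ∈ e.source) : ContDiffAt ℝ ∞ (inChart G e) (e x) := by
  set e₀ := chartAt ℂ (q x)
  have he₀ : e₀ ∈ atlas ℂ M := chart_mem_atlas ℂ (q x)
  have hxe₀ : q x ∈ e₀.source := mem_chart_source ℂ (q x)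
  obtain ⟨h1, -⟩ := hq.coord hX hM he he₀ hxe hxe₀
  have hval : (e₀ ∘ q ∘ e.symm) (e x) = e₀ (q x) := by simp [hxe]
  have hz := e₀.map_source hxe₀
  have hzU : e₀.symm (e₀ (q x)) ∈ U := by rwa [e₀.left_inv hxe₀]
  have hsm := contDiffAt_inChart hM h.isOpen h.smooth he₀ hz hzU
  refine ContDiffAt.congr_of_eventuallyEq ?_
    (inChart_comp_eventuallyEq hq.isLocalHomeomorph.continuous hGF hxe hxe₀)
  refine ContDiffAt.comp (e x) ?_ (h1.contDiffAt.restrict_scalars ℝ)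
  rwa [hval]

/-- A map that is locally a normalized local lift composed with an étale map is a normalized
horizontal lift. -/
lemma isNormalizedHorizontalLift_comp (hX : IsManifold 𝓘(ℂ) ω X) (hM : IsManifold 𝓘(ℂ) ω M)
    (hf : IsMinimalLagrangianImmersion f) {q : X → M} (hq : IsEtale q) {G : X → S5}
    (h : ∀ x, ∃ U F, IsNormLift f U F ∧ q x ∈ U ∧ G =ᶠ[𝓝 x] F ∘ q) :
    IsNormalizedHorizontalLift (f ∘ q) G := by
  refine ⟨⟨fun x => ?_, fun x => ?_, fun e he z hz v => ?_⟩, fun e he z hz => ?_⟩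
  · obtain ⟨U, F, hF, hxU, hG⟩ := h x
    exact contMDiffAt_of_inChart hX (chart_mem_atlas ℂ x) (mem_chart_source ℂ x)
      (contDiffAt_inChart_comp hX hM hF.toIsLocalLift hq hxU hG (chart_mem_atlas ℂ x)
        (mem_chart_source ℂ x))
  · obtain ⟨U, F, hF, hxU, hG⟩ := h x
    rw [hG.self_of_nhds]
    exact hF.lift _ hxU
  · obtain ⟨U, F, hF, hxU, hG⟩ := h (e.symm z)
    have hxe := e.map_target hz
    set e₀ := chartAt ℂ (q (e.symm z))
    have he₀ : e₀ ∈ atlas ℂ M := chart_mem_atlas ℂ _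
    have hxe₀ : q (e.symm z) ∈ e₀.source := mem_chart_source ℂ _
    obtain ⟨h1, -⟩ := hq.coord hX hM he he₀ hxe hxe₀
    have hev := inChart_comp_eventuallyEq hq.isLocalHomeomorph.continuous hG hxe hxe₀
    rw [e.right_inv hz] at h1 hev
    have hval : (e₀ ∘ q ∘ e.symm) z = e₀ (q (e.symm z)) := rfl
    have hz₀ := e₀.map_source hxe₀
    have hzU : e₀.symm (e₀ (q (e.symm z))) ∈ U := by rwa [e₀.left_inv hxe₀]
    have hsm := contDiffAt_inChart hM hF.isOpen hF.smooth he₀ hz₀ hzU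
    rw [pd, hev.fderiv_eq, ← pd, hev.self_of_nhds,
      pd_comp (hsm.differentiableAt (by simp)) h1.differentiableAt.hasDerivAt]
    exact hF.horizontal hM hf he₀ hz₀ hzU _
  · obtain ⟨U, F, hF, hxU, hG⟩ := h (e.symm z)
    have hxe := e.map_target hz
    set e₀ := chartAt ℂ (q (e.symm z))
    have he₀ : e₀ ∈ atlas ℂ M := chart_mem_atlas ℂ _
    have hxe₀ : q (e.symm z) ∈ e₀.source := mem_chart_source ℂ _
    have h1 := frameDet_inChart_comp hX hM hf hF.toIsLocalLift hq hxU hG he hxe he₀ hxe₀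
    rw [e.right_inv hz] at h1
    exact h1.trans (hF.det e₀ he₀ _ (e₀.map_source hxe₀) (by rwa [e₀.left_inv hxe₀]))

/-- It suffices to check that the determinant is one in one coordinate at each point. -/
lemma isNormLift_of_chart (hM : IsManifold 𝓘(ℂ) ω M)
    (hf : IsMinimalLagrangianImmersion f) (h : IsLocalLift f U F)
    (hdet : ∀ x ∈ U, ∃ e ∈ atlas ℂ M, x ∈ e.source ∧ frameDet (inChart F e) (e x) = 1) :
    IsNormLift f U F := by
  refine ⟨h, fun e he z hz hzU => ?_⟩
  obtain ⟨e₀, he₀, hx₀, h1⟩ := hdet _ hzU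
  have h2 := frameDet_inChart_comp hM hM hf h isEtale_id (G := F) (x := e.symm z) hzU
    Filter.EventuallyEq.rfl he (e.map_target hz) he₀ hx₀
  rw [e.right_inv hz] at h2
  exact h2.trans h1

lemma frameDet_rot {M : Type*} [TopologicalSpace M] {F : M → S5} {k : M → Circle}
    {e : OpenPartialHomeomorph M ℂ} {z : ℂ}
    (hF : DifferentiableAt ℝ (inChart F e) z)
    (hk : DifferentiableAt ℝ (fun ζ => (k (e.symm ζ) : ℂ)) z) :
    frameDet (inChart (fun x => rot (k x) (F x)) e) z =
      (k (e.symm z) : ℂ) ^ 3 * frameDet (inChart F e) z :=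
  frameDet_smul (G := inChart F e) (k := fun ζ => (k (e.symm ζ) : ℂ)) hF hk (norm_S5 _)
    (Circle.norm_coe _)

lemma IsNormLift.rot_const (hM : IsManifold 𝓘(ℂ) ω M) (h : IsNormLift f U F) {k : Circle}
    (hk : k ∈ cubeRoots) :
    IsNormLift f U (fun x => rot k (F x)) := by
  refine ⟨⟨h.isOpen, 
    (((k : ℂ) • (1 : C3 →L[ℝ] C3)).contMDiff).comp_contMDiffOn h.smooth, fun x hx => ?_⟩,
    fun e he z hz hzU => ?_⟩
  · rw [hopf_rot]
    exact h.lift x hx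
  · rw [frameDet_rot (k := fun _ => k) ((contDiffAt_inChart hM h.isOpen h.smooth he hz
      hzU).differentiableAt (by simp)) (differentiableAt_const _), h.det e he z hz hzU,
      mem_cubeRoots.mp hk, mul_one]

/-- Through every point there is a normalized local lift. -/
lemma exists_isNormLift (hM : IsManifold 𝓘(ℂ) ω M) (hf : IsMinimalLagrangianImmersion f)
    (x₀ : M) : ∃ U F, IsNormLift f U F ∧ x₀ ∈ U := by
  obtain ⟨V, F, hxV, hF⟩ := hf.smooth x₀
  set e := chartAt ℂ x₀
  have he : e ∈ atlas ℂ M := chart_mem_atlas ℂ x₀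
  have hxe : x₀ ∈ e.source := mem_chart_source ℂ x₀
  set d₀ := frameDet (inChart F e) (e x₀) with hd₀
  have hfr {x : M} (hx : x ∈ e.source) (hxV : x ∈ V) : IsFramed (inChart F e) (e x) :=
    hf.isFramed hF he (e.map_source hx) (by rwa [e.left_inv hx])
  have hd₀1 : ‖d₀‖ = 1 := norm_frameDet (hfr hxe hxV)
  have hd₀0 : d₀ ≠ 0 := by
    intro h
    rw [h, norm_zero] at hd₀1
    exact zero_ne_one hd₀1
  have hsm {x : M} (hx : x ∈ e.source) (hxV : x ∈ V) : ContDiffAt ℝ ∞ (inChart F e) (e x) :=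
    contDiffAt_inChart hM hF.isOpen hF.smooth he (e.map_source hx) (by rwa [e.left_inv hx])
  have hdet {x : M} (hx : x ∈ e.source) (hxV : x ∈ V) :
      ContDiffAt ℝ ∞ (frameDet (inChart F e)) (e x) :=
    contDiffAt_frameDet (hsm hx hxV)
      (hf.eventually_isFramed hF he (e.map_source hx) (by rwa [e.left_inv hx]))
  -- Division by the value at `x₀` puts the determinant near `1`, inside the slit plane where the
  -- logarithm is smooth. Then `θ` is a smooth argument of the determinant, and the cube of `k` is
  -- its inverse.
  let r : ℂ → ℂ := fun ζ => frameDet (inChart F e) ζ / d₀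
  let θ : ℂ → ℝ := fun ζ => (Complex.log (r ζ)).im + (Complex.log d₀).im
  let k : ℂ → Circle := fun ζ => Circle.exp (-(θ ζ) / 3)
  let W : Set M := {x | x ∈ e.source ∧ x ∈ V ∧ r (e x) ∈ Complex.slitPlane}
  have hrc {x : M} (hx : x ∈ e.source) (hxV : x ∈ V) : ContDiffAt ℝ ∞ r (e x) := by
    simp only [r, div_eq_mul_inv]
    exact (hdet hx hxV).mul contDiffAt_const
  have hW : IsOpen W := by
    rw [isOpen_iff_mem_nhds]
    rintro x ⟨hx, hxV, hxr⟩
    filter_upwards [e.open_source.mem_nhds hx, hF.isOpen.mem_nhds hxV,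
      ((hrc hx hxV).continuousAt.comp (e.continuousAt hx)).eventually
        (Complex.isOpen_slitPlane.mem_nhds hxr)] with y h1 h2 h3 using ⟨h1, h2, h3⟩
  have hx₀W : x₀ ∈ W := by
    refine ⟨hxe, hxV, ?_⟩
    simp only [r, ← hd₀, div_self hd₀0]
    exact Complex.one_mem_slitPlane
  have hθ {x : M} (hx : x ∈ W) : ContDiffAt ℝ ∞ θ (e x) := by
    have h1 : ContDiffAt ℝ ∞ Complex.log (r (e x)) :=
      (Complex.contDiffAt_log hx.2.2).restrict_scalars ℝ
    exact (Complex.imCLM.contDiff.contDiffAt.comp (e x) (h1.comp (e x) (hrc hx.1 hx.2.1))).add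
      contDiffAt_const
  have hk {x : M} (hx : x ∈ W) : ContDiffAt ℝ ∞ (fun ζ => (k ζ : ℂ)) (e x) := by
    simp only [k, Circle.coe_exp]
    refine ContDiffAt.cexp ?_
    refine ContDiffAt.mul ?_ contDiffAt_const
    refine Complex.ofRealCLM.contDiff.contDiffAt.comp (e x) ?_
    exact (hθ hx).neg.div_const 3
  have hk3 {x : M} (hx : x ∈ W) : (k (e x) : ℂ) ^ 3 * frameDet (inChart F e) (e x) = 1 := by
    have hlog {w : ℂ} (hw : ‖w‖ = 1) : Complex.exp ((Complex.log w).im * Complex.I) = w := by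
      have h0 : w ≠ 0 := by
        intro h
        rw [h, norm_zero] at hw
        exact zero_ne_one hw
      have h1 : Complex.log w = (Complex.log w).im * Complex.I := by
        apply Complex.ext <;> simp [Complex.log_re, hw]
      rw [← h1, Complex.exp_log h0]
    have hr1 : ‖r (e x)‖ = 1 := by
      simp only [r, norm_div, hd₀1, norm_frameDet (hfr hx.1 hx.2.1), div_one]
    have h1 : (k (e x) : ℂ) ^ 3 * (r (e x) * d₀) = 1 := by
      conv_lhs => rw [← hlog hr1, ← hlog hd₀1]
      simp only [k, Circle.coe_exp, ← Complex.exp_nat_mul, ← Complex.exp_add, θ]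
      rw [← Complex.exp_zero]
      congr 1
      push_cast
      ring
    rwa [show r (e x) * d₀ = frameDet (inChart F e) (e x) from div_mul_cancel₀ _ hd₀0] at h1
  refine ⟨W, fun x => rot (k (e x)) (F x), isNormLift_of_chart hM hf ⟨hW, ?_, ?_⟩ ?_, hx₀W⟩
  · intro x hx
    refine (contMDiffAt_of_inChart hM he hx.1 ?_).contMDiffWithinAt
    refine ContDiffAt.congr_of_eventuallyEq ((hk hx).smul (hsm hx.1 hx.2.1)) ?_
    filter_upwards [e.open_target.mem_nhds (e.map_source hx.1)] with ζ hζ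
    simp [inChart, e.right_inv hζ]
  · intro x hx
    rw [hopf_rot]
    exact hF.lift x hx.2.1
  · intro x hx
    refine ⟨e, he, hx.1, ?_⟩
    rw [frameDet_rot (k := fun x => k (e x)) ((hsm hx.1 hx.2.1).differentiableAt (by simp)),
      e.left_inv hx.1]
    · exact hk3 hx
    · refine DifferentiableAt.congr_of_eventuallyEq ((hk hx).differentiableAt (by simp)) ?_
      filter_upwards [e.open_target.mem_nhds (e.map_source hx.1)] with ζ hζ
      simp [e.right_inv hζ]

/-- Two smooth lifts of the same map whose frames have determinant one at a point differ there by a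
cubic root of unity. -/
lemma exists_cubeRoot {X : Type*} [TopologicalSpace X] {F G : X → S5} {x : X}
    {e : OpenPartialHomeomorph X ℂ}
    (hxe : x ∈ e.source) (hF : ContDiffAt ℝ ∞ (inChart F e) (e x))
    (hG : ContDiffAt ℝ ∞ (inChart G e) (e x)) (h : ∀ᶠ y in 𝓝 x, hopf (G y) = hopf (F y))
    (hF1 : frameDet (inChart F e) (e x) = 1) (hG1 : frameDet (inChart G e) (e x) = 1) :
    ∃ k ∈ cubeRoots, G x = rot k (F x) := by
  -- The gauge is first chosen pointwise, with the default `1` where the images differ. It is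
  -- differentiable at the relevant point because near it `k` is the inner product of `F` and `G`.
  have h1 (y : X) : ∃ k : Circle, hopf (G y) = hopf (F y) → G y = rot k (F y) := by
    by_cases hy : hopf (G y) = hopf (F y)
    · obtain ⟨k, hk⟩ := exists_rot_of_hopf_eq hy
      exact ⟨k, fun _ => hk⟩
    · exact ⟨1, fun h => (hy h).elim⟩
  choose k hk using h1
  have h2 : ∀ᶠ ζ in 𝓝 (e x), G (e.symm ζ) = rot (k (e.symm ζ)) (F (e.symm ζ)) := by
    have : Filter.Tendsto e.symm (𝓝 (e x)) (𝓝 x) := by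
      have := (e.continuousAt_symm (e.map_source hxe)).tendsto
      rwa [e.left_inv hxe] at this
    exact this.eventually (h.mono fun y hy => hk y hy)
  have h3 : DifferentiableAt ℝ (fun ζ => (k (e.symm ζ) : ℂ)) (e x) := by
    refine DifferentiableAt.congr_of_eventuallyEq
      ((hF.inner ℂ hG).differentiableAt (by simp)) ?_
    filter_upwards [h2] with ζ hζ
    simp only [inChart, hζ, inner_rot]
  have h4 : frameDet (inChart G e) (e x) =
      frameDet (inChart (fun y => rot (k y) (F y)) e) (e x) := by
    refine frameDet_congr (h2.mono fun ζ hζ => ?_)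
    simp only [inChart, hζ]
  rw [frameDet_rot (hF.differentiableAt (by simp)) h3, hF1, hG1, mul_one, e.left_inv hxe] at h4
  exact ⟨k x, mem_cubeRoots.mpr h4.symm, hk x h.self_of_nhds⟩

end LocalLift

/-! ### The group of cubic roots of unity -/

/-- The cubic roots of unity in the circle and in the complex numbers. -/
def cubeRootsEquiv : cubeRoots ≃ rootsOfUnity 3 ℂ where
  toFun k := ⟨Circle.toUnits k.1, by
    rw [mem_rootsOfUnity', Circle.toUnits_apply, Units.val_mk0]
    exact mem_cubeRoots.mp k.2⟩
  invFun w := ⟨⟨(w.1 : ℂ), mem_sphere_zero_iff_norm.mpr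
    (Complex.norm_eq_one_of_mem_rootsOfUnity w.2)⟩,
    mem_cubeRoots.mpr ((mem_rootsOfUnity' _ _).mp w.2)⟩
  left_inv k := by ext; simp
  right_inv w := by
    ext
    rfl

lemma card_cubeRoots : Nat.card cubeRoots = 3 := by
  rw [Nat.card_congr cubeRootsEquiv, Complex.card_rootsOfUnity]

instance : Finite cubeRoots := Nat.finite_of_card_ne_zero (by rw [card_cubeRoots]; norm_num)

lemma cubeRoots_ne_bot : cubeRoots ≠ ⊥ := by
  intro h
  have := card_cubeRoots
  rw [h, Subgroup.card_bot] at this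
  norm_num at this

/-- The group has prime order; this is the source of the dichotomy for the image of the multiplier.
-/
lemma eq_bot_or_eq_cubeRoots {H : Subgroup Circle} (h : H ≤ cubeRoots) :
    H = ⊥ ∨ H = cubeRoots := by
  have : Fact (Nat.card cubeRoots).Prime := ⟨by rw [card_cubeRoots]; norm_num⟩
  rcases (H.subgroupOf cubeRoots).eq_bot_or_eq_top_of_prime_card with h1 | h1
  · rw [Subgroup.subgroupOf_eq_bot, disjoint_iff, inf_eq_left.mpr h] at h1
    exact Or.inl h1
  · exact Or.inr (le_antisymm h (Subgroup.subgroupOf_eq_top.mp h1))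

/-- Discreteness of a finite subgroup, which turns continuous gauges into locally constant ones. -/
lemma eventually_eq_one : ∀ᶠ k : Circle in 𝓝 1, k ∈ cubeRoots → k = 1 := by
  have hfin : ((cubeRoots : Set Circle) \ {1}).Finite :=
    (Set.finite_coe_iff.mp (inferInstanceAs (Finite cubeRoots)) :
      (cubeRoots : Set Circle).Finite).subset sdiff_subset
  filter_upwards [hfin.isClosed.isOpen_compl.mem_nhds (by simp)] with k hk hk'
  by_contra h
  exact hk ⟨hk', h⟩

/-! ### The covering space of values of normalized lifts -/

section LiftSpace

variable {X M : Type*} [TopologicalSpace X] [ChartedSpace ℂ X] [TopologicalSpace M]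
  [ChartedSpace ℂ M]

/-- The values of normalized local lifts. -/
def liftSet (f : M → CP2) : Set (M × S5) := {y | ∃ U F, IsNormLift f U F ∧ y.1 ∈ U ∧ F y.1 = y.2}

/-- The space of values of normalized local lifts. -/
abbrev LiftSpace (f : M → CP2) : Type _ := liftSet f

/-- The projection of the space of values of normalized local lifts. -/
def liftProj (f : M → CP2) (y : LiftSpace f) : M := y.1.1

variable {f : M → CP2}

lemma rot_mem_liftSet [hM : IsManifold 𝓘(ℂ) ω M] {x : M} {v : S5} (h : (x, v) ∈ liftSet f)
    {k : Circle} (hk : k ∈ cubeRoots) : (x, rot k v) ∈ liftSet f := by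
  obtain ⟨U, F, hF, hU, hFy⟩ := h
  exact ⟨U, _, hF.rot_const hM hk, hU, congrArg (rot k) hFy⟩

/-- The fibres of the space of values lie in single orbits: the gauge between two normalized lifts
has cube one. -/
lemma exists_rot_of_mem_liftSet [hM : IsManifold 𝓘(ℂ) ω M] {x : M} {v w : S5}
    (hv : (x, v) ∈ liftSet f) (hw : (x, w) ∈ liftSet f) : ∃ k ∈ cubeRoots, w = rot k v := by
  obtain ⟨U, F, hF, hxU, rfl : F x = v⟩ := hv
  obtain ⟨V, G, hG, hxV, rfl : G x = w⟩ := hw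
  have he := chart_mem_atlas ℂ x
  have hxe := mem_chart_source ℂ x
  have hz := (chartAt ℂ x).map_source hxe
  have hxU' : (chartAt ℂ x).symm (chartAt ℂ x x) ∈ U := by rwa [(chartAt ℂ x).left_inv hxe]
  have hxV' : (chartAt ℂ x).symm (chartAt ℂ x x) ∈ V := by rwa [(chartAt ℂ x).left_inv hxe]
  refine exists_cubeRoot hxe (contDiffAt_inChart hM hF.isOpen hF.smooth he hz hxU')
    (contDiffAt_inChart hM hG.isOpen hG.smooth he hz hxV') ?_ (hF.det _ he _ hz hxU')
    (hG.det _ he _ hz hxV')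
  filter_upwards [hF.isOpen.mem_nhds hxU, hG.isOpen.mem_nhds hxV] with y hy hy'
  rw [hF.lift y hy, hG.lift y hy']

/-- A continuous map into the space of values of normalized lifts that agrees with a normalized
lift at a point agrees with it near that point. -/
lemma IsNormLift.eventuallyEq [IsManifold 𝓘(ℂ) ω M] {U : Set M} {F : M → S5}
    (hF : IsNormLift f U F) {Y : Type*} [TopologicalSpace Y]
    {q : Y → M} {G : Y → S5} {y₀ : Y} (hq : ContinuousAt q y₀) (hG : ContinuousAt G y₀)
    (h : ∀ y, (q y, G y) ∈ liftSet f) (hU : q y₀ ∈ U) (hFy : F (q y₀) = G y₀) :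
    G =ᶠ[𝓝 y₀] F ∘ q := by
  have h1 (y : Y) : ∃ k : Circle, q y ∈ U → k ∈ cubeRoots ∧ G y = rot k (F (q y)) := by
    by_cases hy : q y ∈ U
    · obtain ⟨k, hk, hk'⟩ := exists_rot_of_mem_liftSet (v := F (q y)) ⟨U, F, hF, hy, rfl⟩ (h y)
      exact ⟨k, fun _ => ⟨hk, hk'⟩⟩
    · exact ⟨1, fun a => (hy a).elim⟩
  choose k hk using h1
  have hev : ∀ᶠ y in 𝓝 y₀, k y ∈ cubeRoots ∧ G y = rot (k y) (F (q y)) := by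
    filter_upwards [hq.eventually (hF.isOpen.mem_nhds hU)] with y hy using hk y hy
  have hinner : ContinuousAt (fun y => (inner ℂ (F (q y) : C3) (G y : C3) : ℂ)) y₀ := by
    refine ContinuousAt.inner ?_ ?_
    · exact continuous_subtype_val.continuousAt.comp
        (ContinuousAt.comp (g := F) (hF.continuousAt hU) hq)
    · exact continuous_subtype_val.continuousAt.comp hG
  have hk1 : k y₀ = 1 := by
    have := hev.self_of_nhds.2
    rw [hFy] at this
    exact (rot_right_cancel (this.symm.trans (rot_one _).symm))
  -- Near `y₀` the gauge is the inner product of `F ∘ q` and `G`, hence continuous; being a cubic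
  -- root of unity with value `1` at `y₀`, it is `1` nearby.
  have hkc : ContinuousAt k y₀ := by
    refine (IsInducing.mk rfl : IsInducing ((↑) : Circle → ℂ)).continuousAt_iff.mpr
      (hinner.congr ?_)
    filter_upwards [hev] with y hy
    rw [hy.2, inner_rot]
    rfl
  have hkt : Filter.Tendsto k (𝓝 y₀) (𝓝 1) := by
    have := hkc.tendsto
    rwa [hk1] at this
  filter_upwards [hev, hkt.eventually eventually_eq_one] with y hy hy'
  rw [hy.2, hy' hy.1, rot_one, comp_apply]

/-- Normalized horizontal lifts along étale maps are the continuous maps to the space of values of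
normalized lifts. -/
lemma isNormalizedHorizontalLift_of_mem [hM : IsManifold 𝓘(ℂ) ω M] [hX : IsManifold 𝓘(ℂ) ω X]
    (hf : IsMinimalLagrangianImmersion f) {q : X → M} (hq : IsEtale q) {G : X → S5}
    (hG : Continuous G) (h : ∀ x, (q x, G x) ∈ liftSet f) :
    IsNormalizedHorizontalLift (f ∘ q) G :=
  isNormalizedHorizontalLift_comp hX hM hf hq fun x => by
    obtain ⟨U, F, hF, hU, hFx⟩ := h x
    exact ⟨U, F, hF, hU, hF.eventuallyEq hq.isLocalHomeomorph.continuous.continuousAt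
      hG.continuousAt h hU hFx⟩

lemma IsHorizontalLift.continuous {g : X → CP2} {G : X → S5} (h : IsHorizontalLift g G) :
    Continuous G :=
  IsInducing.subtypeVal.continuous_iff.mpr h.smooth.continuous

lemma IsHorizontalLift.isLocalLift {g : X → CP2} {G : X → S5} (h : IsHorizontalLift g G) :
    IsLocalLift g univ G :=
  ⟨isOpen_univ, h.smooth.contMDiffOn, fun x _ => h.lift x⟩

/-- Converse of the preceding correspondence: at each point the lift is compared with `F ∘ q` for a
normalized local lift `F`, and the two differ by a cubic root of unity. -/
lemma IsNormalizedHorizontalLift.mem_liftSet [hM : IsManifold 𝓘(ℂ) ω M]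
    [hX : IsManifold 𝓘(ℂ) ω X] (hf : IsMinimalLagrangianImmersion f) {q : X → M} (hq : IsEtale q)
    {G : X → S5} (hG : IsNormalizedHorizontalLift (f ∘ q) G) (x : X) :
    (q x, G x) ∈ liftSet f := by
  obtain ⟨U, F, hF, hxU⟩ := exists_isNormLift hM hf (q x)
  have he := chart_mem_atlas ℂ x
  have hxe := mem_chart_source ℂ x
  have hz := (chartAt ℂ x).map_source hxe
  have hq' := hq.isLocalHomeomorph.continuous
  have he₀ := chart_mem_atlas ℂ (q x)
  have hxe₀ := mem_chart_source ℂ (q x)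
  have hd : frameDet (inChart (F ∘ q) (chartAt ℂ x)) (chartAt ℂ x x) = 1 := by
    rw [frameDet_inChart_comp hX hM hf hF.toIsLocalLift hq hxU Filter.EventuallyEq.rfl he hxe he₀
      hxe₀]
    exact hF.det _ he₀ _ ((chartAt ℂ (q x)).map_source hxe₀)
      (by rwa [(chartAt ℂ (q x)).left_inv hxe₀])
  obtain ⟨k, hk, hGk⟩ := exists_cubeRoot (F := F ∘ q) (G := G) hxe
    (contDiffAt_inChart_comp hX hM hF.toIsLocalLift hq hxU Filter.EventuallyEq.rfl he hxe)
    (contDiffAt_inChart hX isOpen_univ hG.isHorizontalLift.smooth.contMDiffOn he hz (mem_univ _))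
    (by
      filter_upwards [hq'.continuousAt.eventually (hF.isOpen.mem_nhds hxU)] with y hy
      rw [hG.isHorizontalLift.lift, comp_apply, comp_apply, hF.lift _ hy])
    hd (hG.det_eq_one _ he _ hz)
  rw [hGk]
  exact rot_mem_liftSet ⟨U, F, hF, hxU, rfl⟩ hk

/-- A global horizontal lift can be normalized by a constant. -/
lemma exists_rot_isNormLift [hM : IsManifold 𝓘(ℂ) ω M] [ConnectedSpace M]
    (hf : IsMinimalLagrangianImmersion f) {F : M → S5} (hF : IsHorizontalLift f F) :
    ∃ k : Circle, ∀ x, (x, rot k (F x)) ∈ liftSet f := by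
  have hloc := hF.isLocalLift
  let d : M → ℂ := fun x => frameDet (inChart F (chartAt ℂ x)) (chartAt ℂ x x)
  have hd (x : M) {e : OpenPartialHomeomorph M ℂ} (he : e ∈ atlas ℂ M) (hx : x ∈ e.source) :
      d x = frameDet (inChart F e) (e x) :=
    frameDet_inChart_comp hM hM hf hloc isEtale_id (mem_univ _) Filter.EventuallyEq.rfl
      (chart_mem_atlas ℂ x) (mem_chart_source ℂ x) he hx
  -- The frame determinant is independent of the chart, and horizontality makes its derivative
  -- vanish.
  have hlc : IsLocallyConstant d := by
    rw [IsLocallyConstant.iff_eventually_eq]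
    intro x
    set e := chartAt ℂ x
    have he : e ∈ atlas ℂ M := chart_mem_atlas ℂ x
    have hxe : x ∈ e.source := mem_chart_source ℂ x
    have hdiff : ∀ z ∈ e.target, DifferentiableAt ℝ (frameDet (inChart F e)) z ∧
        fderiv ℝ (frameDet (inChart F e)) z = 0 := by
      intro z hz
      have h1 := contDiffAt_inChart hM isOpen_univ hF.smooth.contMDiffOn he hz (mem_univ _)
      have h2 := hf.eventually_isFramed hloc he hz (mem_univ _)
      refine ⟨(contDiffAt_frameDet h1 h2).differentiableAt (by simp), ?_⟩
      ext v
      rw [fderiv_frameDet h1 h2 (hf.minimal _ _ hloc e he z hz (mem_univ _)),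
        hF.horizontal e he z hz]
      simp
    obtain ⟨r, hr, hball⟩ := Metric.isOpen_iff.mp e.open_target _ (e.map_source hxe)
    have hconst : ∀ z ∈ Metric.ball (e x) r,
        frameDet (inChart F e) z = frameDet (inChart F e) (e x) := fun z hz =>
      Metric.isOpen_ball.is_const_of_fderiv_eq_zero (convex_ball (e x) r).isPreconnected
        (fun w hw => (hdiff w (hball hw)).1.differentiableWithinAt)
        (fun w hw => (hdiff w (hball hw)).2) hz (Metric.mem_ball_self hr)
    filter_upwards [e.open_source.mem_nhds hxe,
      (e.continuousAt hxe).eventually (Metric.ball_mem_nhds _ hr)] with y hy hy'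
    rw [hd y he hy, hd x he hxe, hconst _ hy']
  obtain ⟨x₀⟩ := (inferInstance : Nonempty M)
  have hd1 : ‖d x₀‖ = 1 := norm_frameDet (hf.isFramed hloc (chart_mem_atlas ℂ x₀)
    ((chartAt ℂ x₀).map_source (mem_chart_source ℂ x₀)) (mem_univ _))
  -- The determinant is a constant of modulus one, so a single constant cube root normalizes the
  -- lift everywhere.
  obtain ⟨k, hk⟩ : ∃ k : Circle, (k : ℂ) ^ 3 * d x₀ = 1 := by
    refine ⟨Circle.exp (-(Complex.arg (d x₀)) / 3), ?_⟩
    have h1 := Complex.norm_mul_exp_arg_mul_I (d x₀)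
    rw [hd1, Complex.ofReal_one, one_mul] at h1
    conv_lhs => rw [← h1]
    rw [Circle.coe_exp, ← Complex.exp_nat_mul, ← Complex.exp_add, ← Complex.exp_zero, h1]
    congr 1
    push_cast
    ring
  refine ⟨k, fun x => ⟨univ, fun x => rot k (F x), ?_, mem_univ _, rfl⟩⟩
  refine ⟨⟨isOpen_univ,
    (((k : ℂ) • (1 : C3 →L[ℝ] C3)).contMDiff).comp_contMDiffOn hF.smooth.contMDiffOn,
    fun x _ => ?_⟩, fun e he z hz _ => ?_⟩
  · rw [hopf_rot]
    exact hF.lift x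
  · have h1 := contDiffAt_inChart hM isOpen_univ hF.smooth.contMDiffOn he hz (mem_univ _)
    rw [frameDet_rot (k := fun _ => k) (h1.differentiableAt (by simp)) (differentiableAt_const _),
      ← e.right_inv hz, ← hd _ he (e.map_target hz),
      hlc.apply_eq_of_preconnectedSpace (e.symm z) x₀]
    exact hk

/-! ### The projection is a covering -/

instance [IsManifold 𝓘(ℂ) ω M] : MulAction cubeRoots (LiftSpace f) where
  smul k y := ⟨(y.1.1, rot k.1 y.1.2), rot_mem_liftSet y.2 k.2⟩
  one_smul _ := Subtype.ext (Prod.ext rfl (rot_one _))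
  mul_smul _ _ _ := Subtype.ext (Prod.ext rfl (rot_mul _ _ _))

@[simp] lemma smul_snd [IsManifold 𝓘(ℂ) ω M] (k : cubeRoots) (y : LiftSpace f) :
    (k • y).1.2 = rot k.1 y.1.2 := rfl

lemma continuous_liftProj : Continuous (liftProj f) :=
  continuous_fst.comp continuous_subtype_val

/-- The local inverses are the graphs `x ↦ (x, F x)` of normalized local lifts. Such a graph is open
because a point of the space near it must lie on it, by `IsNormLift.eventuallyEq`. -/
lemma isLocalHomeomorph_liftProj [IsManifold 𝓘(ℂ) ω M] : IsLocalHomeomorph (liftProj f) := by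
  refine IsLocalHomeomorph.mk _ fun y₀ => ?_
  obtain ⟨U, F, hF, hU, hFy⟩ := y₀.2
  let s : U → LiftSpace f := fun x => ⟨(x, F x), U, F, hF, x.2, rfl⟩
  classical
  let e : OpenPartialHomeomorph (LiftSpace f) M :=
    { toFun := liftProj f
      invFun := fun x => if h : x ∈ U then s ⟨x, h⟩ else y₀
      source := {y | y.1.1 ∈ U ∧ F y.1.1 = y.1.2}
      target := U
      map_source' := fun y hy => hy.1
      map_target' := fun x hx => by simp [hx, s]
      left_inv' := fun y hy => by
        have hy' : liftProj f y ∈ U := hy.1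
        simp only [hy', dite_true, s]
        exact Subtype.ext (Prod.ext rfl hy.2)
      right_inv' := fun x hx => by simp [hx, s, liftProj]
      open_source := by
        rw [isOpen_iff_mem_nhds]
        rintro y ⟨hy, hy'⟩
        filter_upwards [(continuous_liftProj.continuousAt (x := y)).eventually
          (hF.isOpen.mem_nhds hy), hF.eventuallyEq (q := fun y : LiftSpace f => y.1.1)
          (G := fun y : LiftSpace f => y.1.2) (y₀ := y) (by fun_prop) (by fun_prop)
          (fun y => y.2) hy hy'] with z hz hz' using ⟨hz, hz'.symm⟩
      open_target := hF.isOpen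
      continuousOn_toFun := continuous_liftProj.continuousOn
      continuousOn_invFun := by
        rw [continuousOn_iff_continuous_domRestrict]
        have : U.domRestrict (fun x => if h : x ∈ U then s ⟨x, h⟩ else y₀) = s :=
          funext fun x => dif_pos x.2
        rw [this]
        refine Continuous.subtype_mk (continuous_subtype_val.prodMk ?_) _
        rw [continuous_iff_continuousAt]
        intro x
        exact (hF.continuousAt x.2).comp continuous_subtype_val.continuousAt }
  exact ⟨e, ⟨hU, hFy⟩, fun _ _ => rfl⟩

lemma liftProj_surjective [hM : IsManifold 𝓘(ℂ) ω M] (hf : IsMinimalLagrangianImmersion f) :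
    Surjective (liftProj f) := by
  intro x
  obtain ⟨U, F, hF, hx⟩ := exists_isNormLift hM hf x
  exact ⟨⟨(x, F x), U, F, hF, hx, rfl⟩, rfl⟩

/-- The projection is a regular covering with group the group of cubic roots of unity. -/
lemma isQuotientCoveringMap_liftProj [hM : IsManifold 𝓘(ℂ) ω M]
    (hf : IsMinimalLagrangianImmersion f) : IsQuotientCoveringMap (liftProj f) cubeRoots := by
  have hloc := isLocalHomeomorph_liftProj (f := f)
  refine
    { toIsQuotientMap := hloc.isOpenMap.isQuotientMap hloc.continuous (liftProj_surjective hf)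
      continuous_const_smul := fun k => ?_
      apply_eq_iff_mem_orbit := fun {y₁ y₂} => ⟨fun h => ?_, ?_⟩
      disjoint := fun y => ?_ }
  · refine Continuous.subtype_mk (Continuous.prodMk (by fun_prop) ?_) _
    exact continuous_rot.comp (by fun_prop : Continuous fun y : LiftSpace f => (k.1, y.1.2))
  · obtain ⟨⟨x, v⟩, h₁⟩ := y₁
    obtain ⟨⟨x', w⟩, h₂⟩ := y₂
    obtain rfl : x = x' := h
    obtain ⟨k, hk, hk'⟩ := exists_rot_of_mem_liftSet h₂ h₁
    exact ⟨⟨k, hk⟩, Subtype.ext (Prod.ext rfl hk'.symm)⟩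
  · rintro ⟨k, rfl⟩
    rfl
  · obtain ⟨e, he, hee⟩ := hloc y
    refine ⟨e.source, e.open_source.mem_nhds he, fun k => ?_⟩
    rintro ⟨_, ⟨y', hy', rfl⟩, hy''⟩
    -- Both points lie in one sheet and have the same projection; freeness of the rotation action
    -- then forces `k = 1`.
    have h1 : k • y' = y' := by
      apply e.injOn hy'' hy'
      rw [← hee]
      rfl
    have h2 := congrArg (fun y : LiftSpace f => y.1.2) h1
    simp only [smul_snd] at h2
    exact Subtype.ext (rot_right_cancel (h2.trans (rot_one _).symm))

/-- Two continuous maps to the space of values of normalized lifts over the same map differ by a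
constant. -/
lemma exists_rot_eq [hM : IsManifold 𝓘(ℂ) ω M] (hf : IsMinimalLagrangianImmersion f)
    {Y : Type*} [TopologicalSpace Y] [ConnectedSpace Y] {q : Y → M} {G H : Y → S5}
    (hq : Continuous q) (hG : Continuous G) (hH : Continuous H)
    (hGm : ∀ y, (q y, G y) ∈ liftSet f) (hHm : ∀ y, (q y, H y) ∈ liftSet f) :
    ∃ k ∈ cubeRoots, ∀ y, H y = rot k (G y) := by
  obtain ⟨y₀⟩ := (inferInstance : Nonempty Y)
  obtain ⟨k, hk, hk'⟩ := exists_rot_of_mem_liftSet (hGm y₀) (hHm y₀)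
  refine ⟨k, hk, fun y => ?_⟩
  -- Both maps lift `q` to the covering and agree at `y₀`, so they agree on the connected space `Y`.
  have h := (isQuotientCoveringMap_liftProj hf).isCoveringMap.eq_of_comp_eq
    (g₁ := fun y => (⟨(q y, H y), hHm y⟩ : LiftSpace f))
    (g₂ := fun y => (⟨(q y, rot k (G y)), rot_mem_liftSet (hGm y) hk⟩ : LiftSpace f))
    (Continuous.subtype_mk (hq.prodMk hH) _)
    (Continuous.subtype_mk (hq.prodMk (continuous_rot.comp
      (by fun_prop : Continuous fun y => (k, G y)))) _) rfl y₀
    (Subtype.ext (Prod.ext rfl hk'))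
  exact congrArg (fun y : LiftSpace f => y.1.2) (congrFun h y)

end LiftSpace

/-! ### The pull back of a complex structure by a local homeomorphism -/

section Pullback

variable {X M : Type*} [TopologicalSpace X] [TopologicalSpace M] [ChartedSpace ℂ M]

/-- The charts obtained from charts of the target of a local homeomorphism. -/
def pullbackAtlas (q : X → M) : Set (OpenPartialHomeomorph X ℂ) :=
  {e' | ∃ s : OpenPartialHomeomorph X M, (s : X → M) = q ∧ ∃ e ∈ atlas ℂ M, e' = s ≫ₕ e}

/-- The pull back of a complex structure by a local homeomorphism. -/
@[reducible] def pullbackChartedSpace {q : X → M} (hq : IsLocalHomeomorph q) :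
    ChartedSpace ℂ X where
  atlas := pullbackAtlas q
  chartAt x := (hq x).choose ≫ₕ chartAt ℂ (q x)
  mem_chart_source x := by
    obtain ⟨h1, h2⟩ := (hq x).choose_spec
    simp only [OpenPartialHomeomorph.trans_source, mem_inter_iff, mem_preimage]
    exact ⟨h1, by rw [← h2]; exact mem_chart_source ℂ (q x)⟩
  chart_mem_atlas x :=
    ⟨_, (hq x).choose_spec.2.symm, _, chart_mem_atlas ℂ (q x), rfl⟩

variable [ChartedSpace ℂ X] {q : X → M}

/-- All the local homeomorphisms `s` are restrictions of the same `q`, so they cancel, and the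
transition maps are restrictions of those of `M`. -/
lemma isManifold_of_pullbackAtlas [hM : IsManifold 𝓘(ℂ) ω M] (hA : atlas ℂ X = pullbackAtlas q) :
    IsManifold 𝓘(ℂ) ω X := by
  refine isManifold_of_contDiffOn _ _ _ fun e₁ e₂ h₁ h₂ => ?_
  rw [hA] at h₁ h₂
  obtain ⟨s₁, hs₁, a₁, ha₁, rfl⟩ := h₁
  obtain ⟨s₂, hs₂, a₂, ha₂, rfl⟩ := h₂
  have h : ContDiffOn ℂ ω (a₂ ∘ a₁.symm) (a₁.symm ≫ₕ a₂).source := by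
    have := (mem_groupoid_of_pregroupoid.mp
      (hM.compatible ha₁ ha₂ : a₁.symm ≫ₕ a₂ ∈ contDiffGroupoid ω 𝓘(ℂ))).1
    simpa [contDiffPregroupoid] using this
  have key : ∀ z ∈ ((s₁ ≫ₕ a₁).symm ≫ₕ s₂ ≫ₕ a₂).source,
      s₂ (s₁.symm (a₁.symm z)) = a₁.symm z ∧ z ∈ (a₁.symm ≫ₕ a₂).source := by
    intro z hz
    simp only [OpenPartialHomeomorph.trans_symm_eq_symm_trans_symm,
      OpenPartialHomeomorph.trans_source, OpenPartialHomeomorph.symm_source, mem_inter_iff,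
      mem_preimage, OpenPartialHomeomorph.coe_trans, comp_apply] at hz ⊢
    have h1 : s₂ (s₁.symm (a₁.symm z)) = a₁.symm z := by
      rw [hs₂, ← hs₁, s₁.right_inv hz.1.2]
    rw [h1] at hz
    exact ⟨h1, hz.1.1, hz.2.2⟩
  have h' : ContDiffOn ℂ ω ((s₁ ≫ₕ a₁).symm ≫ₕ s₂ ≫ₕ a₂)
      ((s₁ ≫ₕ a₁).symm ≫ₕ s₂ ≫ₕ a₂).source := by
    refine (h.mono fun z hz => (key z hz).2).congr fun z hz => ?_
    simp [(key z hz).1]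
  simpa using h'

lemma isEtale_of_pullbackAtlas [hM : IsManifold 𝓘(ℂ) ω M] (hA : atlas ℂ X = pullbackAtlas q)
    (hq : IsLocalHomeomorph q) : IsEtale q := by
  refine ⟨fun x => ?_, hq⟩
  have hX := isManifold_of_pullbackAtlas hA
  have : IsManifold 𝓘(ℂ) 1 X := IsManifold.of_le le_top
  have : IsManifold 𝓘(ℂ) 1 M := IsManifold.of_le le_top
  obtain ⟨s, hx, hs⟩ := hq x
  have hqx := mem_chart_source ℂ (q x)
  have he := chart_mem_atlas ℂ (q x)
  set e := chartAt ℂ (q x)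
  have he' : s ≫ₕ e ∈ atlas ℂ X := by
    rw [hA]
    exact ⟨s, hs.symm, e, he, rfl⟩
  have hxe : x ∈ (s ≫ₕ e).source := by
    rw [OpenPartialHomeomorph.trans_source]
    exact ⟨hx, by rw [mem_preimage, ← hs]; exact hqx⟩
  have h1 : MDifferentiableAt 𝓘(ℂ) 𝓘(ℂ) (e.symm ∘ (s ≫ₕ e)) x := by
    refine (mdifferentiableAt_atlas_symm he ?_).comp x (mdifferentiableAt_atlas he' hxe)
    exact (s ≫ₕ e).map_source hxe |> fun h => h.1
  refine h1.congr_of_eventuallyEq ?_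
  filter_upwards [(s ≫ₕ e).open_source.mem_nhds hxe] with y hy
  rw [OpenPartialHomeomorph.trans_source] at hy
  simp only [comp_apply, OpenPartialHomeomorph.coe_trans]
  rw [e.left_inv hy.2, hs]

/-- A continuous lift of a holomorphic map along an étale map is holomorphic. -/
lemma mdifferentiable_of_comp [hM : IsManifold 𝓘(ℂ) ω M] (hA : atlas ℂ X = pullbackAtlas q)
    (hq : IsLocalHomeomorph q) {D : Type*} [TopologicalSpace D] [ChartedSpace ℂ D] {r : D → X}
    (hr : Continuous r) (hqr : MDifferentiable 𝓘(ℂ) 𝓘(ℂ) (q ∘ r)) :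
    MDifferentiable 𝓘(ℂ) 𝓘(ℂ) r := by
  intro d
  have hX := isManifold_of_pullbackAtlas hA
  have : IsManifold 𝓘(ℂ) 1 X := IsManifold.of_le le_top
  have : IsManifold 𝓘(ℂ) 1 M := IsManifold.of_le le_top
  obtain ⟨s, hx, hs⟩ := hq (r d)
  have hqx := mem_chart_source ℂ (q (r d))
  have he := chart_mem_atlas ℂ (q (r d))
  set e := chartAt ℂ (q (r d))
  have he' : s ≫ₕ e ∈ atlas ℂ X := by
    rw [hA]
    exact ⟨s, hs.symm, e, he, rfl⟩
  have hxe : r d ∈ (s ≫ₕ e).source := by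
    rw [OpenPartialHomeomorph.trans_source]
    exact ⟨hx, by rw [mem_preimage, ← hs]; exact hqx⟩
  have h1 : MDifferentiableAt 𝓘(ℂ) 𝓘(ℂ) ((s ≫ₕ e).symm ∘ e ∘ (q ∘ r)) d := by
    refine MDifferentiableAt.comp d (I' := 𝓘(ℂ)) ?_ ((mdifferentiableAt_atlas he hqx).comp d
      (hqr d))
    refine mdifferentiableAt_atlas_symm he' ?_
    have := (s ≫ₕ e).map_source hxe
    rwa [OpenPartialHomeomorph.coe_trans, ← hs] at this
  refine h1.congr_of_eventuallyEq ?_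
  filter_upwards [hr.continuousAt ((s ≫ₕ e).open_source.mem_nhds hxe)] with y hy
  have := (s ≫ₕ e).left_inv hy
  rw [OpenPartialHomeomorph.coe_trans, ← hs] at this
  exact this.symm

/-- The composition of a minimal Lagrangian immersion with a local homeomorphism is a minimal
Lagrangian immersion for the pulled back complex structure. -/
lemma IsMinimalLagrangianImmersion.comp_pullback [hM : IsManifold 𝓘(ℂ) ω M] {f : M → CP2}
    (hf : IsMinimalLagrangianImmersion f) (hA : atlas ℂ X = pullbackAtlas q)
    (hq : IsLocalHomeomorph q) : IsMinimalLagrangianImmersion (f ∘ q) := by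
  have hX := isManifold_of_pullbackAtlas hA
  have het := isEtale_of_pullbackAtlas hA hq
  -- Every chart upstairs is a sheet `s` followed by a chart of `M`. Pushing a local lift down along
  -- `s` leaves its coordinate expression literally unchanged, so all pointwise conditions transfer.
  have key (U : Set X) (F : X → S5) (hF : IsLocalLift (f ∘ q) U F) (e' : OpenPartialHomeomorph X ℂ)
      (he' : e' ∈ atlas ℂ X) (z : ℂ) (hz : z ∈ e'.target) (hzU : e'.symm z ∈ U) :
      ∃ (V : Set M) (G : M → S5) (e : OpenPartialHomeomorph M ℂ), IsLocalLift f V G ∧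
        e ∈ atlas ℂ M ∧ z ∈ e.target ∧ e.symm z ∈ V ∧ inChart F e' = inChart G e := by
    rw [hA] at he'
    obtain ⟨s, hs, e, he, rfl⟩ := he'
    rw [OpenPartialHomeomorph.trans_target] at hz
    refine ⟨s.target ∩ s.symm ⁻¹' U, F ∘ s.symm, e, ⟨s.symm.isOpen_inter_preimage hF.isOpen, ?_,
      ?_⟩, he, hz.1, ⟨hz.2, hzU⟩, rfl⟩
    · rintro y ⟨hy, hyU⟩
      have hye := mem_chart_source ℂ y
      have ha := chart_mem_atlas ℂ y
      set a := chartAt ℂ y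
      refine (contMDiffAt_of_inChart hM ha hye ?_).contMDiffWithinAt
      have hsa : s ≫ₕ a ∈ atlas ℂ X := by
        rw [hA]
        exact ⟨s, hs, a, ha, rfl⟩
      have h2 : inChart (F ∘ s.symm) a = inChart F (s ≫ₕ a) := rfl
      rw [h2]
      refine contDiffAt_inChart hX hF.isOpen hF.smooth hsa ?_ ?_
      · rw [OpenPartialHomeomorph.trans_target]
        exact ⟨a.map_source hye, by rwa [mem_preimage, a.left_inv hye]⟩
      · rw [OpenPartialHomeomorph.trans_symm_eq_symm_trans_symm, OpenPartialHomeomorph.coe_trans,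
          comp_apply, a.left_inv hye]
        exact hyU
    · rintro y ⟨hy, hyU⟩
      rw [comp_apply, hF.lift _ hyU, comp_apply, ← hs, s.right_inv hy]
  refine ⟨fun x => ?_, ?_, ?_, ?_, ?_⟩
  · obtain ⟨U, F, hxU, hF⟩ := hf.smooth (q x)
    refine ⟨q ⁻¹' U, F ∘ q, hxU, hF.isOpen.preimage hq.continuous, fun y hy => ?_, fun y hy => ?_⟩
    · exact (contMDiffAt_of_inChart hX (chart_mem_atlas ℂ y) (mem_chart_source ℂ y)
        (contDiffAt_inChart_comp hX hM hF het hy Filter.EventuallyEq.rfl (chart_mem_atlas ℂ y)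
          (mem_chart_source ℂ y))).contMDiffWithinAt
    · exact hF.lift _ hy
  · intro U F hF e' he' z hz hzU
    obtain ⟨V, G, e, hG, he, h1, h2, h3⟩ := key U F hF e' he' z hz hzU
    rw [h3]
    exact hf.immersive V G hG e he z h1 h2
  · intro U F hF e' he' z hz hzU
    obtain ⟨V, G, e, hG, he, h1, h2, h3⟩ := key U F hF e' he' z hz hzU
    rw [h3]
    exact hf.conformal V G hG e he z h1 h2
  · intro U F hF e' he' z hz hzU
    obtain ⟨V, G, e, hG, he, h1, h2, h3⟩ := key U F hF e' he' z hz hzU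
    rw [h3]
    exact hf.lagrangian V G hG e he z h1 h2
  · intro U F hF e' he' z hz hzU
    obtain ⟨V, G, e, hG, he, h1, h2, h3⟩ := key U F hF e' he' z hz hzU
    rw [h3]
    exact hf.minimal V G hG e he z h1 h2

end Pullback

/-! ### Coverings and deck transformations -/

lemma isCoveringMap_homeomorph {X Y : Type*} [TopologicalSpace X] [TopologicalSpace Y]
    (h : X ≃ₜ Y) : IsCoveringMap h := fun _ =>
  IsEvenlyCovered.to_isEvenlyCovered_preimage (I := Unit) ⟨inferInstance, univ, mem_univ _,
    isOpen_univ, isOpen_univ, (Homeomorph.Set.univ X).trans (h.trans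
      ((Homeomorph.Set.univ Y).symm.trans (Homeomorph.prodPUnit _).symm)), fun _ => rfl⟩

/-- Paths of the base of a covering lift to joined points. -/
lemma exists_joined_of_isCoveringMap {X Y : Type*} [TopologicalSpace X] [TopologicalSpace Y]
    {p : X → Y} (hp : IsCoveringMap p) [PathConnectedSpace Y] (x : X) (y : Y) :
    ∃ x', p x' = y ∧ Joined x x' := by
  let γ := PathConnectedSpace.somePath (p x) y
  obtain ⟨Γ, hΓ, hΓ0⟩ := hp.exists_path_lifts γ.toContinuousMap x γ.source
  exact ⟨Γ 1, (congrFun hΓ 1).trans γ.target, ⟨⟨Γ, hΓ0, rfl⟩⟩⟩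

section Deck

variable {D M : Type*} [TopologicalSpace D] [TopologicalSpace M] {p : D → M}

lemma deckGroup_eq_of_apply_eq [PreconnectedSpace D] (hp : IsCoveringMap p) {γ δ : D ≃ₜ D}
    (hγ : γ ∈ deckGroup p) (hδ : δ ∈ deckGroup p) {x : D} (h : γ x = δ x) : γ = δ := by
  ext y
  refine congrFun (hp.eq_of_comp_eq γ.continuous δ.continuous ?_ x h) y
  ext z
  exact (hγ z).trans (hδ z).symm

/-- The map `p` lifts through itself in both directions; each composite lifts `p` and fixes a point,
hence is the identity. -/
lemma exists_deckGroup_apply_eq [SimplyConnectedSpace D] [LocallyPathConnectedSpace D]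
    (hp : IsCoveringMap p) {x y : D} (h : p x = p y) : ∃ γ ∈ deckGroup p, γ x = y := by
  let P : C(D, M) := ⟨p, hp.continuous⟩
  have key (a b : D) (hab : p a = p b) : ∃ F : C(D, D), F a = b ∧ p ∘ F = p :=
    (hp.existsUnique_continuousMap_lifts P a b hab.symm).exists
  obtain ⟨F, hF, hpF⟩ := key x y h
  obtain ⟨G, hG, hpG⟩ := key y x h.symm
  have hGF : G ∘ F = id := by
    refine hp.eq_of_comp_eq (G.continuous.comp F.continuous) continuous_id ?_ x ?_
    · rw [← comp_assoc, hpG, hpF, comp_id]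
    · simp [hF, hG]
  have hFG : F ∘ G = id := by
    refine hp.eq_of_comp_eq (F.continuous.comp G.continuous) continuous_id ?_ y ?_
    · rw [← comp_assoc, hpF, hpG, comp_id]
    · simp [hF, hG]
  exact ⟨⟨⟨F, G, congrFun hGF, congrFun hFG⟩, F.continuous, G.continuous⟩, congrFun hpF, hF⟩

/-- The quotient by a group of deck transformations is a covering. -/
lemma isQuotientCoveringMap_deckGroup [PreconnectedSpace D] (hp : IsCoveringMap p)
    (H : Subgroup (deckGroup p)) :
    IsQuotientCoveringMap (Quotient.mk (MulAction.orbitRel H D)) H where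
  toIsQuotientMap := isQuotientMap_quotient_mk'
  continuous_const_smul γ := γ.1.1.continuous
  apply_eq_iff_mem_orbit := Quotient.eq''
  disjoint x := by
    obtain ⟨s, hs, hps⟩ := hp.isLocalHomeomorph x
    refine ⟨s.source, s.open_source.mem_nhds hs, fun γ => ?_⟩
    rintro ⟨_, ⟨y, hy, rfl⟩, hy'⟩
    have h1 : γ.1.1 y = y := by
      apply s.injOn hy' hy
      rw [← hps]
      exact γ.1.2 y
    exact Subtype.ext (Subtype.ext (deckGroup_eq_of_apply_eq hp γ.1.2 (one_mem _) h1))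

/-- A deck transformation of the quotient map is one of `p`, and at one point it agrees with an
element of `H`; deck transformations of `p` that agree at a point are equal. -/
lemma deckGroup_quotient [SimplyConnectedSpace D] (hp : IsCoveringMap p)
    (H : Subgroup (deckGroup p)) :
    deckGroup (Quotient.mk (MulAction.orbitRel H D)) = H.map (deckGroup p).subtype := by
  ext γ
  constructor
  · intro hγ
    obtain ⟨x⟩ := (inferInstance : Nonempty D)
    have h1 (y : D) : ∃ δ : H, δ • y = γ y :=
      (isQuotientCoveringMap_deckGroup hp H).apply_eq_iff_mem_orbit.mp (hγ y)
    have h2 : γ ∈ deckGroup p := fun y => by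
      obtain ⟨δ, hδ⟩ := h1 y
      rw [← hδ]
      exact δ.1.2 y
    obtain ⟨δ, hδ⟩ := h1 x
    have h3 : δ.1.1 = γ := deckGroup_eq_of_apply_eq hp δ.1.2 h2 hδ
    exact ⟨δ.1, δ.2, h3⟩
  · rintro ⟨δ, hδ, rfl⟩ x
    exact (isQuotientCoveringMap_deckGroup hp H).apply_eq_iff_mem_orbit.mpr ⟨⟨δ, hδ⟩, rfl⟩

end Deck

/-! ### The alternative for the immersion -/

section Alternative

variable {M : Type*} [TopologicalSpace M] [ChartedSpace ℂ M] {f : M → CP2}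

/-- If there is no global horizontal lift, then the space of values of normalized lifts is path
connected. -/
lemma pathConnectedSpace_liftSpace (hM : IsRiemannSurface M)
    (hf : IsMinimalLagrangianImmersion f) (h : ¬ ∃ F : M → S5, IsHorizontalLift f F) :
    PathConnectedSpace (LiftSpace f) := by
  have hmf := hM.holomorphic
  have hMc := hM.connected
  have hqc := isQuotientCoveringMap_liftProj hf
  have hcov := hqc.isCoveringMap
  have hcs := hqc.toContinuousConstSMul
  have hlM : LocallyPathConnectedSpace M := ChartedSpace.locallyPathConnectedSpace ℂ M
  have hpM : PathConnectedSpace M := pathConnectedSpace_iff_connectedSpace.mpr hMc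
  -- The charts serve here only to give local path connectedness, so that path components are open.
  let : ChartedSpace ℂ (LiftSpace f) := pullbackChartedSpace hcov.isLocalHomeomorph
  have hlE : LocallyPathConnectedSpace (LiftSpace f) :=
    ChartedSpace.locallyPathConnectedSpace ℂ (LiftSpace f)
  obtain ⟨x₀⟩ := (inferInstance : Nonempty M)
  obtain ⟨y₀, -⟩ := liftProj_surjective hf x₀
  -- The stabilizer of the path component of `y₀`. If it is trivial, the component meets each fibre
  -- exactly once and its inverse projection yields a global lift; if it is everything, all fibres
  -- lie in one component.
  let H : Subgroup cubeRoots :=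
    { carrier := {k | Joined y₀ (k • y₀)}
      one_mem' := by
        rw [mem_ofPred_eq, one_smul]
      mul_mem' := fun {k l} hk hl => by
        rw [mem_ofPred_eq, mul_smul]
        exact hk.trans (hl.map (continuous_const_smul k))
      inv_mem' := fun {k} hk => by
        have := hk.map (continuous_const_smul k⁻¹)
        rw [inv_smul_smul] at this
        exact this.symm }
  have : Fact (Nat.card cubeRoots).Prime := ⟨by rw [card_cubeRoots]; norm_num⟩
  rcases H.eq_bot_or_eq_top_of_prime_card with hH | hH
  · exfalso
    let C := pathComponent y₀
    have hCo : IsOpen C := IsOpen.pathComponent y₀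
    let τ : C → M := fun y => liftProj f y.1
    have hτ : IsLocalHomeomorph τ :=
      hcov.isLocalHomeomorph.comp hCo.isOpenEmbedding_subtypeVal.isLocalHomeomorph
    have hbij : Bijective τ := by
      refine ⟨fun a b hab => ?_, fun x => ?_⟩
      · obtain ⟨k, hk⟩ := hqc.apply_eq_iff_mem_orbit.mp hab
        have h1 : Joined (k • y₀) a.1 := by
          rw [← hk]
          exact b.2.map (continuous_const_smul k)
        have h2 : k ∈ H := a.2.trans h1.symm
        rw [hH, Subgroup.mem_bot] at h2
        simp only [h2, one_smul] at hk
        exact Subtype.ext hk.symm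
      · obtain ⟨y, hy, hj⟩ := exists_joined_of_isCoveringMap hcov y₀ x
        exact ⟨⟨y, hj⟩, hy⟩
    let e := hτ.toHomeomorphOfBijective hbij
    have he (x : M) : (e.symm x).1.1.1 = x := e.apply_symm_apply x
    refine h ⟨fun x => (e.symm x).1.1.2, (isNormalizedHorizontalLift_of_mem hf isEtale_id
      ((continuous_snd.comp continuous_subtype_val).comp
        (continuous_subtype_val.comp e.symm.continuous)) fun x => ?_).isHorizontalLift⟩
    have h1 := (e.symm x).1.2
    have h2 : (e.symm x).1.1 = (x, (e.symm x).1.1.2) := Prod.ext (he x) rfl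
    rw [h2] at h1
    exact h1
  · have hj (y : LiftSpace f) : Joined y y₀ := by
      obtain ⟨y', hy', hj⟩ := exists_joined_of_isCoveringMap hcov y (liftProj f y₀)
      obtain ⟨k, rfl⟩ := hqc.apply_eq_iff_mem_orbit.mp hy'
      have hk : k ∈ H := by rw [hH]; trivial
      exact hj.trans (Joined.symm hk)
    exact ⟨⟨y₀⟩, fun a b => (hj a).trans (hj b).symm⟩

lemma card_fiber_liftProj [IsManifold 𝓘(ℂ) ω M] (hf : IsMinimalLagrangianImmersion f) (x : M) :
    Nat.card (liftProj f ⁻¹' {x}) = 3 := by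
  obtain ⟨y, hy⟩ := liftProj_surjective hf x
  rw [Nat.card_congr ((isQuotientCoveringMap_liftProj hf).fiberEquivGroup ⟨y, hy⟩),
    card_cubeRoots]

/-- The image of the fundamental group of a path connected regular covering. -/
lemma fundamentalGroup_quotient {E X : Type*} [TopologicalSpace E] [TopologicalSpace X]
    [PathConnectedSpace E] {G : Type*} [CommGroup G] [MulAction G E] (τ : C(E, X))
    (hτ : IsQuotientCoveringMap τ G) (y : E) :
    ∃ _ : (FundamentalGroup.map τ y).range.Normal,
      Nonempty (FundamentalGroup X (τ y) ⧸ (FundamentalGroup.map τ y).range ≃* G) := by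
  let e : τ ⁻¹' {τ y} := ⟨y, rfl⟩
  -- The loops acting trivially on the fibre are those coming from loops at `y` upstairs.
  have h1 : (hτ.fundamentalGroupToMulOpposite e).ker = (FundamentalGroup.map τ y).range := by
    rw [hτ.ker_fundamentalGroupToMulOpposite, hτ.ker_monodromyPerm e]
    congr 1
    ext γ
    exact (FundamentalGroup.mapOfEq_apply τ (rfl : τ y = τ y) γ).trans
      (Path.Homotopic.Quotient.cast_rfl_rfl _)
  have hn : (FundamentalGroup.map τ y).range.Normal := by
    rw [← h1]
    infer_instance
  refine ⟨hn, ⟨?_⟩⟩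
  -- Monodromy takes values in the opposite group, which is identified with `G` because `G` is
  -- commutative.
  exact (QuotientGroup.quotientMulEquivOfEq h1.symm).trans
    ((QuotientGroup.quotientKerEquivOfSurjective _
      (hτ.fundamentalGroupToMulOpposite_surjective e)).trans MulOpposite.opMulEquiv.symm)

end Alternative

/-- The covering is `LiftSpace f` with the pulled back complex structure, and the horizontal lift on
it is the tautological one, the second projection. -/
theorem exists_threefold_covering {M : Type u} [TopologicalSpace M] [ChartedSpace ℂ M]
    (hM : IsRiemannSurface M) (f : M → CP2) (hf : IsMinimalLagrangianImmersion f)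
    (h : ¬ ∃ F₀ : M → S5, IsHorizontalLift f F₀) :
    ∃ (N : Type u) (_ : TopologicalSpace N) (_ : ChartedSpace ℂ N) (τ : C(N, M)),
      IsRiemannSurface N ∧
      IsHolomorphicCovering τ ∧
      (∀ x : M, Nat.card (τ ⁻¹' {x}) = 3) ∧
      IsMinimalLagrangianImmersion (f ∘ τ) ∧
      (∃ Fhat : N → S5, IsHorizontalLift (f ∘ τ) Fhat) ∧
      ∀ y : N, ∃ _ : (FundamentalGroup.map τ y).range.Normal,
        Nonempty (FundamentalGroup M (τ y) ⧸ (FundamentalGroup.map τ y).range ≃* cubeRoots) := by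
  have hmf := hM.holomorphic
  have hT2 := hM.t2
  have hqc := isQuotientCoveringMap_liftProj hf
  have hlh := hqc.isCoveringMap.isLocalHomeomorph
  have hpc := pathConnectedSpace_liftSpace hM hf h
  let cs : ChartedSpace ℂ (LiftSpace f) := pullbackChartedSpace hlh
  have hA : atlas ℂ (LiftSpace f) = pullbackAtlas (liftProj f) := rfl
  have hE := isManifold_of_pullbackAtlas hA
  have het := isEtale_of_pullbackAtlas hA hlh
  refine ⟨LiftSpace f, inferInstance, cs, ⟨liftProj f, continuous_liftProj⟩,
    ⟨inferInstance, inferInstance, hE⟩, ⟨hqc.isCoveringMap, het.holomorphic⟩,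
    card_fiber_liftProj hf, hf.comp_pullback hA hlh, ⟨fun y => y.1.2, ?_⟩,
    fun y => fundamentalGroup_quotient _ hqc y⟩
  exact (isNormalizedHorizontalLift_of_mem hf het (continuous_snd.comp continuous_subtype_val)
    fun y => y.2).isHorizontalLift

/-! ### The universal covering -/

section Universal

variable {M : Type*} [TopologicalSpace M] [ChartedSpace ℂ M] {f : M → CP2}
  {D : Type*} [TopologicalSpace D] [ChartedSpace ℂ D] {p : D → M}

/-- Since `D` is simply connected, `p` lifts to the covering `liftProj f`. -/
theorem exists_isNormalizedHorizontalLift (hM : IsRiemannSurface M)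
    (hf : IsMinimalLagrangianImmersion f) (hD : IsRiemannSurface D) [SimplyConnectedSpace D]
    (hp : IsHolomorphicCovering p) : ∃ F : D → S5, IsNormalizedHorizontalLift (f ∘ p) F := by
  have hmf := hM.holomorphic
  have hDm := hD.holomorphic
  have : LocallyPathConnectedSpace D := ChartedSpace.locallyPathConnectedSpace ℂ D
  obtain ⟨d⟩ := (inferInstance : Nonempty D)
  obtain ⟨y, hy⟩ := liftProj_surjective hf (p d)
  have hcov := (isQuotientCoveringMap_liftProj hf).isCoveringMap
  obtain ⟨Φ, -, hΦ⟩ :=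
    (hcov.existsUnique_continuousMap_lifts ⟨p, hp.covering.continuous⟩ d y hy).exists
  refine ⟨fun x => (Φ x).1.2, isNormalizedHorizontalLift_of_mem hf hp.isEtale
    (continuous_snd.comp (continuous_subtype_val.comp Φ.continuous)) fun x => ?_⟩
  have h1 : (Φ x).1.1 = p x := congrFun hΦ x
  have h2 : (Φ x).1 = (p x, (Φ x).1.2) := Prod.ext h1 rfl
  rw [← h2]
  exact (Φ x).2

/-- The multiplier of a normalized horizontal lift along a covering. -/
theorem exists_multiplier (hM : IsRiemannSurface M) (hf : IsMinimalLagrangianImmersion f)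
    (hD : IsRiemannSurface D) (hp : IsHolomorphicCovering p) {F : D → S5}
    (hF : IsNormalizedHorizontalLift (f ∘ p) F) :
    ∃ c : deckGroup p →* Circle, (∀ (γ : deckGroup p) (x : D), F (γ • x) = rot (c γ) (F x)) ∧
      c.range ≤ cubeRoots := by
  have hmf := hM.holomorphic
  have hDm := hD.holomorphic
  have hDc := hD.connected
  have hFc := hF.isHorizontalLift.continuous
  have hFm := hF.mem_liftSet hf hp.isEtale
  -- Both `F ∘ γ` and `F` are normalized lifts over the same map `p`.
  have key (γ : deckGroup p) : ∃ k ∈ cubeRoots, ∀ x, F (γ • x) = rot k (F x) := by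
    refine exists_rot_eq hf hp.covering.continuous hFc (hFc.comp γ.1.continuous) hFm fun x => ?_
    have := hFm (γ.1 x)
    rwa [γ.2 x] at this
  choose c hc hcF using key
  obtain ⟨d⟩ := (inferInstance : Nonempty D)
  refine ⟨{ toFun := c, map_one' := ?_, map_mul' := fun γ δ => ?_ }, hcF, ?_⟩
  · have := hcF 1 d
    rw [one_smul] at this
    exact (rot_right_cancel (this.symm.trans (rot_one _).symm))
  · have := hcF (γ * δ) d
    rw [mul_smul, hcF, hcF, ← rot_mul] at this
    exact rot_right_cancel this.symm
  · rintro _ ⟨γ, rfl⟩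
    exact hc γ

lemma surjective_of_isCoveringMap {M D : Type*} [TopologicalSpace M] [ChartedSpace ℂ M]
    [TopologicalSpace D] {p : D → M} (hM : IsRiemannSurface M) [Nonempty D] (hp : IsCoveringMap p) :
    Surjective p := by
  have hMc := hM.connected
  have hlM : LocallyPathConnectedSpace M := ChartedSpace.locallyPathConnectedSpace ℂ M
  have hpM : PathConnectedSpace M := pathConnectedSpace_iff_connectedSpace.mpr hMc
  obtain ⟨d⟩ := (inferInstance : Nonempty D)
  intro x
  obtain ⟨y, hy, -⟩ := exists_joined_of_isCoveringMap hp d x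
  exact ⟨y, hy⟩

/-- The lift descends to `HatM c` because `c.ker` fixes it. The resulting map `Ψ` to `LiftSpace f`
controls the topology of the quotient, and the complex structure is pulled back from `M`. -/
theorem exists_multiplier_structure (hM : IsRiemannSurface M)
    (hf : IsMinimalLagrangianImmersion f) (hD : IsRiemannSurface D) [SimplyConnectedSpace D]
    (hp : IsHolomorphicCovering p) {F : D → S5} (hF : IsNormalizedHorizontalLift (f ∘ p) F) :
    ∃ c : deckGroup p →* Circle,
      (∀ (γ : deckGroup p) (x : D), (F (γ • x) : C3) = (c γ : ℂ) • (F x : C3)) ∧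
      (∀ γ : deckGroup p, c γ ^ 3 = 1) ∧
      (c.range = ⊥ ∨ c.range = cubeRoots) ∧
      ∃ _ : ChartedSpace ℂ (HatM c),
        IsRiemannSurface (HatM c) ∧
        IsHolomorphicCovering (toHatM c) ∧
        IsHolomorphicCovering (fromHatM c) ∧
        deckGroup (toHatM c) = c.ker.map (deckGroup p).subtype ∧
        IsMinimalLagrangianImmersion (f ∘ fromHatM c) ∧
        ∃ Fhat : HatM c → S5,
          Fhat ∘ toHatM c = F ∧
          IsHorizontalLift (f ∘ fromHatM c) Fhat ∧
          ((c.range = ⊥ ∧ Bijective (fromHatM c) ∧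
              ∃ F₀ : M → S5, IsHorizontalLift f F₀ ∧ F₀ ∘ p = F) ∨
            (c.range = cubeRoots ∧ (∀ x : M, Nat.card (fromHatM c ⁻¹' {x}) = 3) ∧
              (¬ ∃ F₀ : M → S5, IsHorizontalLift f F₀) ∧
              Nonempty (deckGroup p ⧸ c.ker ≃* cubeRoots))) := by
  obtain ⟨c, hcF, hc⟩ := exists_multiplier hM hf hD hp hF
  have hmf := hM.holomorphic
  have hMT2 := hM.t2
  have hMc := hM.connected
  have hDm := hD.holomorphic
  have hDc := hD.connected
  have hFc := hF.isHorizontalLift.continuous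
  have hFm := hF.mem_liftSet hf hp.isEtale
  have : LocallyPathConnectedSpace D := ChartedSpace.locallyPathConnectedSpace ℂ D
  have hsurj := surjective_of_isCoveringMap hM hp.covering
  have htq : IsQuotientCoveringMap (toHatM c) c.ker := isQuotientCoveringMap_deckGroup hp.covering _
  have htc := htq.isCoveringMap
  have hcomp : fromHatM c ∘ toHatM c = p := rfl
  have hlh : IsLocalHomeomorph (fromHatM c) := by
    rw [isLocalHomeomorph_iff_isLocalHomeomorphOn_univ, ← image_univ_of_surjective htq.surjective]
    exact IsLocalHomeomorphOn.of_comp_right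
      (by rw [hcomp]; exact hp.covering.isLocalHomeomorph.isLocalHomeomorphOn)
      htc.isLocalHomeomorph.isLocalHomeomorphOn
  let Fhat : HatM c → S5 := Quotient.lift F (by
    rintro a b ⟨γ, rfl⟩
    have h1 : c γ.1 = 1 := γ.2
    have h2 := hcF γ.1 b
    rw [h1, rot_one] at h2
    exact h2)
  have hFhatF : Fhat ∘ toHatM c = F := rfl
  have hFhatc : Continuous Fhat := hFc.quotient_lift _
  have hFhatm (x : HatM c) : (fromHatM c x, Fhat x) ∈ liftSet f := by
    obtain ⟨d, rfl⟩ := htq.surjective x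
    exact hFm d
  have hdeck {d d' : D} (h : p d = p d') : ∃ γ : deckGroup p, γ • d = d' := by
    obtain ⟨γ, hγ, h'⟩ := exists_deckGroup_apply_eq hp.covering h
    exact ⟨⟨γ, hγ⟩, h'⟩
  have hsame {d : D} {γ : deckGroup p} (hγ : c γ = 1) : toHatM c (γ • d) = toHatM c d :=
    htq.apply_eq_iff_mem_orbit.mpr ⟨⟨γ, hγ⟩, rfl⟩
  let Ψ : HatM c → LiftSpace f := fun x => ⟨(fromHatM c x, Fhat x), hFhatm x⟩
  have hΨc : Continuous Ψ := Continuous.subtype_mk (hlh.continuous.prodMk hFhatc) _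
  -- Points of `D` with the same image in `M` differ by a deck transformation; equal values of the
  -- lift force its multiplier to be `1`.
  have hΨi : Injective Ψ := by
    intro x y hxy
    obtain ⟨d, rfl⟩ := htq.surjective x
    obtain ⟨d', rfl⟩ := htq.surjective y
    have h1 : p d = p d' := congrArg (fun y : LiftSpace f => y.1.1) hxy
    have h2 : F d = F d' := congrArg (fun y : LiftSpace f => y.1.2) hxy
    obtain ⟨γ, rfl⟩ := hdeck h1
    rw [hcF] at h2
    exact (hsame (rot_right_cancel (h2.symm.trans (rot_one _).symm))).symm
  -- The target is a subspace of `M × S5`, hence Hausdorff.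
  have hT2 : T2Space (HatM c) := T2Space.of_injective_continuous hΨi hΨc
  have hbot (h : c.range = ⊥) : Bijective (fromHatM c) := by
    refine ⟨fun x y hxy => ?_, fun x => ?_⟩
    · obtain ⟨d, rfl⟩ := htq.surjective x
      obtain ⟨d', rfl⟩ := htq.surjective y
      obtain ⟨γ, rfl⟩ := hdeck (show p d = p d' from hxy)
      refine (hsame ?_).symm
      have : c γ ∈ c.range := ⟨γ, rfl⟩
      rwa [h, Subgroup.mem_bot] at this
    · obtain ⟨d, rfl⟩ := hsurj x
      exact ⟨toHatM c d, rfl⟩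
  have hΨs (h : c.range = cubeRoots) : Bijective Ψ := by
    refine ⟨hΨi, fun y => ?_⟩
    obtain ⟨⟨x, v⟩, hy⟩ := y
    obtain ⟨d, rfl⟩ := hsurj x
    obtain ⟨k, hk, rfl⟩ := exists_rot_of_mem_liftSet (hFm d) hy
    rw [← h] at hk
    obtain ⟨γ, rfl⟩ := hk
    exact ⟨toHatM c (γ • d), Subtype.ext (Prod.ext (γ.2 d) (hcF γ d))⟩
  have hΨl : IsLocalHomeomorph Ψ :=
    IsLocalHomeomorph.of_comp (g := liftProj f) hlh isLocalHomeomorph_liftProj hΨc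
  have hdich := eq_bot_or_eq_cubeRoots hc
  -- For trivial `c` the map is a homeomorphism onto `M`; otherwise `Ψ` is a homeomorphism over `M`
  -- onto the covering `LiftSpace f`.
  have hcov : IsCoveringMap (fromHatM c) := by
    rcases hdich with h | h
    · exact isCoveringMap_homeomorph (hlh.toHomeomorphOfBijective (hbot h))
    · exact (isQuotientCoveringMap_liftProj hf).isCoveringMap.comp_homeomorph
        (hΨl.toHomeomorphOfBijective (hΨs h))
  let cs : ChartedSpace ℂ (HatM c) := pullbackChartedSpace hlh
  have hA : atlas ℂ (HatM c) = pullbackAtlas (fromHatM c) := rfl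
  have hX := isManifold_of_pullbackAtlas hA
  have het := isEtale_of_pullbackAtlas hA hlh
  refine ⟨c, fun γ x => congrArg Subtype.val (hcF γ x), fun γ => hc ⟨γ, rfl⟩, hdich, cs,
    ⟨hT2, htq.surjective.connectedSpace htc.continuous, hX⟩,
    ⟨htc, mdifferentiable_of_comp hA hlh htc.continuous hp.holomorphic⟩, ⟨hcov, het.holomorphic⟩,
    deckGroup_quotient hp.covering _, hf.comp_pullback hA hlh, Fhat, hFhatF,
    (isNormalizedHorizontalLift_of_mem hf het hFhatc hFhatm).isHorizontalLift, ?_⟩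
  rcases hdich with h | h
  · refine Or.inl ⟨h, hbot h, ?_⟩
    let e := hlh.toHomeomorphOfBijective (hbot h)
    refine ⟨Fhat ∘ e.symm, (isNormalizedHorizontalLift_of_mem hf isEtale_id
      (hFhatc.comp e.symm.continuous) fun x => ?_).isHorizontalLift, ?_⟩
    · have h1 := hFhatm (e.symm x)
      have h2 : fromHatM c (e.symm x) = x := e.apply_symm_apply x
      rwa [h2] at h1
    · ext1 d
      have : e.symm (p d) = toHatM c d := e.symm_apply_apply (toHatM c d)
      rw [comp_apply, comp_apply, this]
      rfl
  · refine Or.inr ⟨h, fun x => ?_, ?_, ?_⟩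
    · have h1 : fromHatM c = liftProj f ∘ Ψ := rfl
      rw [h1, preimage_comp, Nat.card_preimage_of_injective hΨi (by simp [(hΨs h).2.range_eq])]
      exact card_fiber_liftProj hf x
    -- A global lift, rotated to be normalized and pulled back by `p`, is invariant under deck
    -- transformations. The lift `F` is a constant multiple of it, so `c` would be trivial.
    · rintro ⟨F₀, hF₀⟩
      obtain ⟨k, hk⟩ := exists_rot_isNormLift hf hF₀
      obtain ⟨l, hl, hl'⟩ := exists_rot_eq hf (q := p) (G := fun d => rot k (F₀ (p d))) (H := F)
        hp.covering.continuous (continuous_rot.comp (continuous_const.prodMk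
          (hF₀.continuous.comp hp.covering.continuous))) hFc (fun d => hk (p d)) hFm
      obtain ⟨d⟩ := (inferInstance : Nonempty D)
      refine cubeRoots_ne_bot (h.symm.trans ?_)
      rw [Subgroup.eq_bot_iff_forall]
      rintro _ ⟨γ, rfl⟩
      have h1 := hcF γ d
      have h2 : p (γ • d) = p d := γ.2 d
      rw [hl', h2, ← hl'] at h1
      exact (rot_right_cancel (h1.symm.trans (rot_one _).symm))
    · exact ⟨(QuotientGroup.quotientKerEquivRange c).trans (MulEquiv.subgroupCongr h)⟩

end Universal

end

end MinLag

/-! ### The main theorem -/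

theorem mainTheorem3 {M : Type u} [TopologicalSpace M] [ChartedSpace ℂ M]
    (hM : IsRiemannSurface M)
    (hS : IsEmpty (M ≃ₜ Metric.sphere (0 : EuclideanSpace ℝ (Fin 3)) 1))
    (f : M → CP2) (hf : IsMinimalLagrangianImmersion f) :
    -- the multiplier on the universal covering
    (∀ (D : Type v) [TopologicalSpace D] [ChartedSpace ℂ D], IsRiemannSurface D →
      SimplyConnectedSpace D → ∀ p : D → M, IsHolomorphicCovering p →
      (∃ F : D → S5, IsNormalizedHorizontalLift (f ∘ p) F) ∧
      ∀ F : D → S5, IsNormalizedHorizontalLift (f ∘ p) F →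
        ∃ c : deckGroup p →* Circle,
          (∀ (γ : deckGroup p) (x : D), (F (γ • x) : C3) = (c γ : ℂ) • (F x : C3)) ∧
          (∀ γ : deckGroup p, c γ ^ 3 = 1) ∧
          (c.range = ⊥ ∨ c.range = cubeRoots) ∧
          ∃ _ : ChartedSpace ℂ (HatM c),
            IsRiemannSurface (HatM c) ∧
            IsHolomorphicCovering (toHatM c) ∧
            IsHolomorphicCovering (fromHatM c) ∧
            deckGroup (toHatM c) = c.ker.map (deckGroup p).subtype ∧
            IsMinimalLagrangianImmersion (f ∘ fromHatM c) ∧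
            ∃ Fhat : HatM c → S5,
              Fhat ∘ toHatM c = F ∧
              IsHorizontalLift (f ∘ fromHatM c) Fhat ∧
              ((c.range = ⊥ ∧ Bijective (fromHatM c) ∧
                  ∃ F₀ : M → S5, IsHorizontalLift f F₀ ∧ F₀ ∘ p = F) ∨
                (c.range = cubeRoots ∧ (∀ x : M, Nat.card (fromHatM c ⁻¹' {x}) = 3) ∧
                  (¬ ∃ F₀ : M → S5, IsHorizontalLift f F₀) ∧
                  Nonempty (deckGroup p ⧸ c.ker ≃* cubeRoots)))) ∧
    -- the alternative for the immersion
    ((∃ F₀ : M → S5, IsHorizontalLift f F₀) ∨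
      ((¬ ∃ F₀ : M → S5, IsHorizontalLift f F₀) ∧
        ∃ (N : Type u) (_ : TopologicalSpace N) (_ : ChartedSpace ℂ N) (τ : C(N, M)),
          IsRiemannSurface N ∧
          IsHolomorphicCovering τ ∧
          (∀ x : M, Nat.card (τ ⁻¹' {x}) = 3) ∧
          IsMinimalLagrangianImmersion (f ∘ τ) ∧
          (∃ Fhat : N → S5, IsHorizontalLift (f ∘ τ) Fhat) ∧
          ∀ y : N, ∃ _ : (FundamentalGroup.map τ y).range.Normal,
            Nonempty (FundamentalGroup M (τ y) ⧸ (FundamentalGroup.map τ y).range ≃*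
              cubeRoots))) := by
  refine ⟨fun D _ _ hD hsc p hp => ⟨exists_isNormalizedHorizontalLift hM hf hD hp, fun F hF =>
    exists_multiplier_structure hM hf hD hp hF⟩, ?_⟩
  by_cases h : ∃ F₀ : M → S5, IsHorizontalLift f F₀
  · exact Or.inl h
  · exact Or.inr ⟨h, exists_threefold_covering hM f hf h⟩
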